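/- Let $\mathbb{T}$ be the unit circle with normalized Haar measure $m$. For $1\le p\le\infty$ let $H^p(\mathbb{T})$ be the subspace, with the norm of $L^p(\mathbb{T})$, of all $f\in L^p(\mathbb{T})$ with $\widehat f(n)=\int_{\mathbb{T}} f(z)\,\overline{z^{n}}\,dm(z)=0$ for every integer $n<0$, and write $\langle f,g\rangle=\int_{\mathbb{T}} f\,\overline{g}\,dm$ whenever $f\overline g$ is integrable. For $f,\varphi\in H^p(\mathbb{T})$, the relation $\langle f,\varphi\rangle=0$ has this literal meaning if $p\ge 2$; if $1\le p<2$, it means by definition that $f$ lies in the closure in $H^p(\mathbb{T})$ of the set of analytic polynomials $g$ with $\langle g,\varphi\rangle=0$. A function $\varphi\in H^p(\mathbb{T})$, $\varphi\neq 0$, is called a Hilbert point in $H^p(\mathbb{T})$ if \[\|\varphi\|_{H^p(\mathbb{T})}\le\|\varphi+f\|_{H^p(\mathbb{T})}\quad\text{for every } f\in H^p(\mathbb{T}) \text{ with } \langle f,\varphi\rangle=0.\] A function $I\in H^p(\mathbb{T})$ is called inner if $|I(z)|=1$ for almost every $z\in\mathbb{T}$. Theorem. Fix $1\le p\le\infty$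 with $p\ne 2$. A function $\varphi\in L^p(\mathbb{T})$ is a Hilbert point in $H^p(\mathbb{T})$ if and only if $\varphi=CI$ for some constant $C\in\mathbb{C}$, $C\neq 0$, and some inner function $I\in H^p(\mathbb{T})$. -/

import Mathlib

open MeasureTheory AddCircle
open scoped ENNReal Real ComplexConjugate

/-- The unit circle `𝕋`, with `θ` modulo `2π` standing for the point `exp (i θ)`. Its measure is
always `haarAddCircle`, the Haar measure of total mass one. -/
abbrev Torus : Type := AddCircle (2 * π)

instance Torus.instFactPos : Fact (0 < 2 * π) := ⟨Real.two_pi_pos⟩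

/-- `L^p(𝕋)` for the normalized Haar measure. -/
abbrev LpTorus (p : ℝ≥0∞) : Type := Lp ℂ p (haarAddCircle : Measure Torus)

theorem LpTorus.integrable {p : ℝ≥0∞} [Fact (1 ≤ p)] (f : LpTorus p) :
    Integrable f haarAddCircle :=
  (Lp.memLp f).integrable Fact.out

/-- The Hardy space `H^p(𝕋)`: the functions in `L^p(𝕋)` all of whose Fourier coefficients of
negative index vanish. Its norm is the norm of `L^p(𝕋)`. -/
noncomputable def hardySpace (p : ℝ≥0∞) [Fact (1 ≤ p)] : Submodule ℂ (LpTorus p) where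
  carrier := {f | ∀ n : ℤ, n < 0 → fourierCoeff (f : Torus → ℂ) n = 0}
  zero_mem' := by
    intro n _
    rw [fourierCoeff_congr_ae (Lp.coeFn_zero ℂ p haarAddCircle)]
    simp [fourierCoeff]
  add_mem' := by
    intro f g hf hg n hn
    rw [fourierCoeff_congr_ae (Lp.coeFn_add f g),
      fourierCoeff.add (LpTorus.integrable f) (LpTorus.integrable g), Pi.add_apply,
      hf n hn, hg n hn, add_zero]
  smul_mem' := by
    intro c f hf n hn
    rw [fourierCoeff_congr_ae (Lp.coeFn_smul c f), fourierCoeff.const_smul, hf n hn, smul_zero]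

/-- The pairing `⟨f, g⟩ = ∫ f \bar g` of `L^2(𝕋)`, for functions whose product is integrable. -/
noncomputable def pairing (f g : Torus → ℂ) : ℂ :=
  ∫ t, f t * conj (g t) ∂haarAddCircle

/-- The analytic polynomial `z ↦ P z` on the circle, as an element of `L^p(𝕋)`. -/
noncomputable def polyLp (p : ℝ≥0∞) [Fact (1 ≤ p)] (P : Polynomial ℂ) : LpTorus p :=
  ContinuousMap.toLp (E := ℂ) p haarAddCircle ℂ P.toAddCircle

/-- The relation `⟨f, φ⟩ = 0` between functions in `H^p(𝕋)`. For `2 ≤ p` it is meant literally, the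
product being integrable. For `p < 2`, where it need not be, it means that `f` is a limit in the
`p`-norm of analytic polynomials `g` with `⟨g, φ⟩ = 0`. -/
def IsOrthogonalTo {p : ℝ≥0∞} [Fact (1 ≤ p)] (f φ : LpTorus p) : Prop :=
  (2 ≤ p → pairing f φ = 0) ∧
  (p < 2 → f ∈ closure {g : LpTorus p | ∃ P : Polynomial ℂ, g = polyLp p P ∧ pairing g φ = 0})

/-- `φ` is a Hilbert point in `H^p(𝕋)`. -/
def IsHilbertPoint {p : ℝ≥0∞} [Fact (1 ≤ p)] (φ : LpTorus p) : Prop :=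
  φ ∈ hardySpace p ∧ φ ≠ 0 ∧ ∀ f ∈ hardySpace p, IsOrthogonalTo f φ → ‖φ‖ ≤ ‖φ + f‖

/-- `I` is an inner function: an element of the Hardy space which is unimodular almost everywhere
on the circle. -/
def IsInner {p : ℝ≥0∞} [Fact (1 ≤ p)] (I : LpTorus p) : Prop :=
  I ∈ hardySpace p ∧ ∀ᵐ t ∂(haarAddCircle : Measure Torus), ‖I t‖ = 1

open Filter Topology

/-! If `|φ| = c` almost everywhere and `f` is orthogonal to `φ`, then `c² = ⟨φ + f, φ⟩ ≤ c ‖φ + f‖₁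
≤ c ‖φ + f‖_p`, and `‖φ‖ = c`; this is the easy direction.

Conversely, let `φ` be a Hilbert point and `H` bounded and analytic. A multiple of `φ H` minus `φ`
is orthogonal to `φ`, which gives `‖φ‖ |∫ H |φ|²| ≤ ‖φ H‖ ∫ |φ|²` (`IsHilbertPoint.norm_mul_le`).
Everything follows from the choice of `H`.

For `p < ∞`, take `H = 1 + ε w zⁿ` with `|w| = 1`. The first order in `ε` shows that `|φ|²` and
`|φ|^p`, normalized to mass one, have the same Fourier coefficients, hence agree
(`IsHilbertPoint.rpow_norm_ae_eq`). As `p ≠ 2`, the modulus is constant where `φ ≠ 0`.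

For `p = ∞`, take `H = exp (s F)` with `Re F` the indicator of `E = {|φ| ≤ (1 - δ) ‖φ‖}`. For small
`s` the sup norm does not grow, while `∫ H |φ|²` gains `s ∫_E |φ|²` to first order; so `φ = 0` on
`E` (`IsHilbertPoint.ae_eq_zero_or_lt`).

In both cases `φ` cannot vanish on a set of positive measure. The same exponentials prove this for
`H²` (`ae_ne_zero_of_mem_hardySpace`).

For `p < 2`, `φ` must be shown to lie in `L²` before `|φ|²` makes sense. If the pairing with `φ`
were unbounded on polynomials, its kernel would be dense, and `f = -φ` would be admissible;
boundedness then forces square summable coefficients. -/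

/-! ### Fourier coefficients: uniqueness and products -/

theorem norm_fourier_apply (n : ℤ) (t : Torus) : ‖fourier n t‖ = 1 :=
  Circle.norm_coe _

theorem norm_fourierCoeff_le (f : Torus → ℂ) (n : ℤ) :
    ‖fourierCoeff f n‖ ≤ ∫ t, ‖f t‖ ∂haarAddCircle := by
  refine (norm_integral_le_integral_norm _).trans_eq ?_
  refine integral_congr_ae (Eventually.of_forall fun t => ?_)
  simp only [norm_smul, norm_fourier_apply, one_mul]

theorem fourierCoeff_sub {f g : Torus → ℂ} (hf : Integrable f haarAddCircle)
    (hg : Integrable g haarAddCircle) (n : ℤ) :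
    fourierCoeff (f - g) n = fourierCoeff f n - fourierCoeff g n := by
  have h : f - g = f + (-1 : ℂ) • g := by ext; simp [sub_eq_add_neg]
  rw [h, fourierCoeff.add hf (hg.smul _), Pi.add_apply, fourierCoeff.const_smul]
  simp [sub_eq_add_neg]

theorem fourierCoeff_fourier_mul (f : Torus → ℂ) (m n : ℤ) :
    fourierCoeff (fun t => fourier m t * f t) n = fourierCoeff f (n - m) := by
  refine integral_congr_ae (Eventually.of_forall fun t => ?_)
  simp only [smul_eq_mul]
  rw [← mul_assoc, ← fourier_add]
  congr 2; congr 1; ring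

theorem fourierCoeff_conj (f : Torus → ℂ) (n : ℤ) :
    fourierCoeff (fun t => conj (f t)) n = conj (fourierCoeff f (-n)) := by
  rw [fourierCoeff, fourierCoeff, ← integral_conj]
  refine integral_congr_ae (Eventually.of_forall fun t => ?_)
  simp only [smul_eq_mul, map_mul, ← fourier_neg, neg_neg]

theorem fourierCoeff_zero_eq_integral (f : Torus → ℂ) :
    fourierCoeff f 0 = ∫ t, f t ∂haarAddCircle := by
  simp [fourierCoeff]

/-- A function orthogonal to all the monomials is orthogonal to all continuous functions. -/
theorem integral_continuousMap_mul_eq_zero {f : Torus → ℂ} (hf : Integrable f haarAddCircle)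
    (h : ∀ n, fourierCoeff f n = 0) (g : C(Torus, ℂ)) :
    ∫ t, g t * f t ∂haarAddCircle = 0 := by
  have hint (g : C(Torus, ℂ)) : Integrable (fun t => g t * f t) haarAddCircle :=
    hf.bdd_mul (c := ‖g‖) g.continuous.aestronglyMeasurable
      (Eventually.of_forall g.norm_coe_le_norm)
  let L : C(Torus, ℂ) →ₗ[ℂ] ℂ :=
    { toFun := fun g => ∫ t, g t * f t ∂haarAddCircle
      map_add' := fun g₁ g₂ => by
        simp only [ContinuousMap.add_apply, add_mul]
        exact integral_add (hint g₁) (hint g₂)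
      map_smul' := fun c g => by
        simp only [ContinuousMap.smul_apply, smul_eq_mul, mul_assoc, RingHom.id_apply]
        exact integral_const_mul _ _ }
  let L' : C(Torus, ℂ) →L[ℂ] ℂ := L.mkContinuous (∫ t, ‖f t‖ ∂haarAddCircle) fun g => by
    refine (norm_integral_le_integral_norm _).trans ?_
    rw [mul_comm (∫ t, ‖f t‖ ∂haarAddCircle), ← integral_const_mul]
    refine integral_mono (hint g).norm (hf.norm.const_mul _) fun t => ?_
    simp only [norm_mul]
    gcongr
    exact g.norm_coe_le_norm t
  have hle : (Submodule.span ℂ (Set.range (@fourier (2 * π)))).topologicalClosure ≤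
      LinearMap.ker L'.toLinearMap := by
    refine Submodule.topologicalClosure_minimal _ (Submodule.span_le.2 ?_) L'.isClosed_ker
    rintro _ ⟨n, rfl⟩
    have := h (-n)
    simp only [fourierCoeff, neg_neg, smul_eq_mul] at this
    exact this
  rw [span_fourier_closure_eq_top] at hle
  exact hle (Submodule.mem_top (x := g))

/-- An integrable function is determined by its Fourier coefficients. -/
theorem ae_eq_zero_of_fourierCoeff_eq_zero {f : Torus → ℂ} (hf : Integrable f haarAddCircle)
    (h : ∀ n, fourierCoeff f n = 0) : f =ᵐ[haarAddCircle] 0 := by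
  refine ae_eq_zero_of_forall_setIntegral_isClosed_eq_zero hf fun s hs => ?_
  -- The indicator of the closed set `s` is a bounded pointwise limit of continuous functions,
  -- against which `f` integrates to zero.
  have hlim : Tendsto (fun n => ∫ t, ((hs.apprSeq n t : ℝ) : ℂ) * f t ∂haarAddCircle) atTop
      (𝓝 (∫ t, s.indicator f t ∂haarAddCircle)) := by
    refine tendsto_integral_of_dominated_convergence (fun t => ‖f t‖) (fun n => ?_) hf.norm
      (fun n => Eventually.of_forall fun t => ?_) (Eventually.of_forall fun t => ?_)
    · refine AEStronglyMeasurable.mul (Continuous.aestronglyMeasurable ?_) hf.1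
      have := (hs.apprSeq n).continuous
      fun_prop
    · rw [norm_mul]
      have h1 : hs.apprSeq n t ≤ 1 := HasOuterApproxClosed.apprSeq_apply_le_one hs n t
      have : ‖((hs.apprSeq n t : ℝ) : ℂ)‖ ≤ 1 := by
        simpa using h1
      exact mul_le_of_le_one_left (norm_nonneg _) this
    · have h1 := (tendsto_pi_nhds.1 (HasOuterApproxClosed.tendsto_apprSeq hs)) t
      have h2 : Tendsto (fun n => ((hs.apprSeq n t : ℝ) : ℂ) * f t) atTop
          (𝓝 (((s.indicator (fun _ => (1 : NNReal)) t : NNReal) : ℝ) * f t)) := by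
        refine Tendsto.mul_const _ ?_
        exact (Complex.continuous_ofReal.tendsto _).comp
          ((NNReal.continuous_coe.tendsto _).comp h1)
      convert h2 using 2
      by_cases ht : t ∈ s <;> simp [ht]
  rw [integral_indicator hs.measurableSet] at hlim
  have h0 (n : ℕ) : ∫ t, ((hs.apprSeq n t : ℝ) : ℂ) * f t ∂haarAddCircle = 0 :=
    integral_continuousMap_mul_eq_zero hf h ⟨fun t => ((hs.apprSeq n t : ℝ) : ℂ), by
      have := (hs.apprSeq n).continuous
      fun_prop⟩
  simp only [h0] at hlim
  exact (tendsto_nhds_unique hlim tendsto_const_nhds)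

theorem ae_eq_of_fourierCoeff_eq {f g : Torus → ℂ} (hf : Integrable f haarAddCircle)
    (hg : Integrable g haarAddCircle) (h : ∀ n, fourierCoeff f n = fourierCoeff g n) :
    f =ᵐ[haarAddCircle] g := by
  have := ae_eq_zero_of_fourierCoeff_eq_zero (hf.sub hg) fun n => by
    rw [fourierCoeff_sub hf hg, h, sub_self]
  filter_upwards [this] with t ht
  simpa [sub_eq_zero] using ht

/-- The Fourier coefficients of a product of square integrable functions are given by the
convolution of the coefficients. -/
theorem hasSum_fourierCoeff_mul {f g : Torus → ℂ} (hf : MemLp f 2 haarAddCircle)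
    (hg : MemLp g 2 haarAddCircle) (n : ℤ) :
    HasSum (fun k => fourierCoeff f (n - k) * fourierCoeff g k)
      (fourierCoeff (fun t => f t * g t) n) := by
  -- The inner product of this function with `g` is the `n`-th coefficient of `f g`, so Parseval
  -- gives the convolution.
  have hx : MemLp (fun t => fourier n t * conj (f t)) 2 haarAddCircle := by
    refine MemLp.of_le hf ((fourier n).continuous.aestronglyMeasurable.mul
      (Complex.continuous_conj.comp_aestronglyMeasurable hf.1)) (Eventually.of_forall fun t => ?_)
    rw [norm_mul, norm_fourier_apply, one_mul, RCLike.norm_conj]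
  have key := fourierBasis.hasSum_inner_mul_inner (hx.toLp _) (hg.toLp _)
  have hrepr {u : Torus → ℂ} (hu : MemLp u 2 haarAddCircle) (k : ℤ) :
      inner ℂ (fourierBasis k) (hu.toLp u) = fourierCoeff u k := by
    rw [← fourierBasis.repr_apply_apply, fourierBasis_repr,
      fourierCoeff_congr_ae hu.coeFn_toLp]
  convert! key using 1
  · ext k
    rw [hrepr hg, ← inner_conj_symm, hrepr hx, fourierCoeff_fourier_mul, fourierCoeff_conj,
      Complex.conj_conj, neg_sub]
  · rw [L2.inner_def]
    refine integral_congr_ae ?_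
    filter_upwards [hx.coeFn_toLp, hg.coeFn_toLp] with t h1 h2
    rw [h1, h2, RCLike.inner_apply', fourier_neg]
    simp only [smul_eq_mul, map_mul, Complex.conj_conj]
    ring

/-- The indices `n - k` and `k` add up to `n < 0`, so one of them is negative in each term of the
convolution. -/
theorem fourierCoeff_mul_of_neg {f g : Torus → ℂ} (hf : MemLp f 2 haarAddCircle)
    (hg : MemLp g 2 haarAddCircle) (hf' : ∀ n < 0, fourierCoeff f n = 0)
    (hg' : ∀ n < 0, fourierCoeff g n = 0) {n : ℤ} (hn : n < 0) :
    fourierCoeff (fun t => f t * g t) n = 0 := by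
  refine (hasSum_fourierCoeff_mul hf hg n).unique ?_
  convert hasSum_zero using 2 with k
  rcases lt_or_ge k 0 with hk | hk
  · rw [hg' k hk, mul_zero]
  · rw [hf' _ (by omega), zero_mul]

/-- Only `k = 0` survives in the convolution: a positive `k` puts `n - k` below `n`. -/
theorem fourierCoeff_mul_of_lowest {f g : Torus → ℂ} (hf : MemLp f 2 haarAddCircle)
    (hg : MemLp g 2 haarAddCircle) {n : ℤ} (hf' : ∀ k < n, fourierCoeff f k = 0)
    (hg' : ∀ k < 0, fourierCoeff g k = 0) :
    fourierCoeff (fun t => f t * g t) n = fourierCoeff f n * fourierCoeff g 0 := by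
  refine (hasSum_fourierCoeff_mul hf hg n).unique ?_
  convert! hasSum_single (f := fun k => fourierCoeff f (n - k) * fourierCoeff g k) 0 ?_ using 1
  · simp
  · intro k hk
    rcases lt_or_ge k 0 with hk' | hk'
    · simp [hg' k hk']
    · simp [hf' (n - k) (by omega)]

/-! ### Coefficient functionals and polynomials in `L^p` -/

theorem LpTorus.integral_norm_le {p : ℝ≥0∞} [hp : Fact (1 ≤ p)] (f : LpTorus p) :
    ∫ t, ‖f t‖ ∂haarAddCircle ≤ ‖f‖ := by
  rw [integral_norm_eq_lintegral_enorm (Lp.aestronglyMeasurable f), ← eLpNorm_one_eq_lintegral_enorm,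
    Lp.norm_def]
  exact ENNReal.toReal_mono (Lp.eLpNorm_ne_top f)
    (eLpNorm_le_eLpNorm_of_exponent_le hp.out (Lp.aestronglyMeasurable f))

/-- The `n`-th Fourier coefficient as a continuous functional on `L^p`. -/
noncomputable def fourierCoeffCLM (p : ℝ≥0∞) [Fact (1 ≤ p)] (n : ℤ) : LpTorus p →L[ℂ] ℂ :=
  LinearMap.mkContinuous
    { toFun := fun f => fourierCoeff (f : Torus → ℂ) n
      map_add' := fun f g => by
        rw [fourierCoeff_congr_ae (Lp.coeFn_add f g),
          fourierCoeff.add (LpTorus.integrable f) (LpTorus.integrable g), Pi.add_apply]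
      map_smul' := fun c f => by
        rw [fourierCoeff_congr_ae (Lp.coeFn_smul c f), fourierCoeff.const_smul, RingHom.id_apply] }
    1 fun f => by
      rw [one_mul]
      exact (norm_fourierCoeff_le _ _).trans (LpTorus.integral_norm_le f)

theorem fourierCoeffCLM_apply {p : ℝ≥0∞} [Fact (1 ≤ p)] (n : ℤ) (f : LpTorus p) :
    fourierCoeffCLM p n f = fourierCoeff (f : Torus → ℂ) n := rfl

theorem LpTorus.eq_of_fourierCoeff_eq {p : ℝ≥0∞} [Fact (1 ≤ p)] {f g : LpTorus p}
    (h : ∀ n, fourierCoeff (f : Torus → ℂ) n = fourierCoeff (g : Torus → ℂ) n) : f = g :=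
  Lp.ext (ae_eq_of_fourierCoeff_eq (LpTorus.integrable f) (LpTorus.integrable g) h)

theorem coeFn_polyLp (p : ℝ≥0∞) [Fact (1 ≤ p)] (P : Polynomial ℂ) :
    polyLp p P =ᵐ[haarAddCircle] P.toAddCircle :=
  ContinuousMap.coeFn_toLp _ _

theorem fourierCoeff_polyLp (p : ℝ≥0∞) [Fact (1 ≤ p)] (P : Polynomial ℂ) (n : ℤ) :
    fourierCoeff (polyLp p P : Torus → ℂ) n = if 0 ≤ n then P.coeff n.natAbs else 0 := by
  rw [fourierCoeff_congr_ae (coeFn_polyLp p P)]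
  exact P.fourierCoeff_toAddCircle n

/-- Analytic polynomials as a linear map into `L^p`. -/
noncomputable def polyLpₗ (p : ℝ≥0∞) [Fact (1 ≤ p)] : Polynomial ℂ →ₗ[ℂ] LpTorus p :=
  (ContinuousMap.toLp (E := ℂ) p haarAddCircle ℂ).toLinearMap ∘ₗ
    (Polynomial.toAddCircle : Polynomial ℂ →ₐ[ℂ] _).toLinearMap

theorem polyLpₗ_apply (p : ℝ≥0∞) [Fact (1 ≤ p)] (P : Polynomial ℂ) :
    polyLpₗ p P = polyLp p P := rfl

/-! ### Translation and density of analytic polynomials -/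

/-- The translateLp `x ↦ f (t + x)` of a function in `L^p`. -/
noncomputable def translateLp {p : ℝ≥0∞} (f : LpTorus p) (t : Torus) : LpTorus p :=
  DomAddAct.mk t +ᵥ f

theorem coeFn_translateLp {p : ℝ≥0∞} (f : LpTorus p) (t : Torus) :
    translateLp f t =ᵐ[haarAddCircle] fun x => f (t + x) :=
  DomAddAct.vadd_Lp_ae_eq _ _

theorem translateLp_zero {p : ℝ≥0∞} (f : LpTorus p) : translateLp f 0 = f := by
  refine Lp.ext ((coeFn_translateLp f 0).trans ?_)
  simp

theorem continuous_translateLp {p : ℝ≥0∞} [Fact (1 ≤ p)] (hp : p ≠ ∞) (f : LpTorus p) :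
    Continuous (translateLp f) := by
  have : Fact (p ≠ ∞) := ⟨hp⟩
  have : Continuous (DomAddAct.mk : Torus → _) := by fun_prop
  unfold translateLp
  fun_prop

theorem fourierCoeff_translateLp {p : ℝ≥0∞} (f : LpTorus p) (t : Torus) (n : ℤ) :
    fourierCoeff (translateLp f t : Torus → ℂ) n = fourier n t * fourierCoeff (f : Torus → ℂ) n := by
  rw [fourierCoeff_congr_ae (coeFn_translateLp f t)]
  simp only [fourierCoeff, smul_eq_mul]
  rw [← integral_const_mul, ← integral_add_left_eq_self
    (fun x => fourier n t * (fourier (-n) x * f x)) t]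
  refine integral_congr_ae (Eventually.of_forall fun x => ?_)
  have h (x : Torus) : fourier (-n) x * fourier n x = 1 := by
    rw [← fourier_add, neg_add_cancel, fourier_zero]
  have h2 : fourier (-n) (t + x) = fourier (-n) t * fourier (-n) x := by
    simp [fourier_apply, toCircle_add, smul_add]
  simp only [h2]
  linear_combination (-fourier (-n) x * f (t + x)) * h t

/-- Each coefficient functional passes under the `L^p`-valued integral, where translation has become
multiplication by a character; orthogonality of characters leaves one frequency. -/
theorem integral_fourier_smul_translateLp {p : ℝ≥0∞} [Fact (1 ≤ p)] (hp : p ≠ ∞) (f : LpTorus p)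
    (k : ℤ) : ∫ t, fourier k t • translateLp f t ∂haarAddCircle =
      fourierCoeff (f : Torus → ℂ) (-k) • fourierLp p (-k) := by
  refine LpTorus.eq_of_fourierCoeff_eq fun n => ?_
  have hcont : Continuous fun t => fourier k t • translateLp f t :=
    (fourier k).continuous.smul (continuous_translateLp hp f)
  rw [← fourierCoeffCLM_apply, ← fourierCoeffCLM_apply, map_smul,
    ← ContinuousLinearMap.integral_comp_comm _
      (hcont.integrable_of_hasCompactSupport (HasCompactSupport.of_compactSpace _))]
  simp only [map_smul, fourierCoeffCLM_apply, fourierCoeff_translateLp, smul_eq_mul]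
  rw [fourierCoeff_congr_ae (coeFn_fourierLp p (-k)), fourierCoeff_fourier]
  have h (t : Torus) : fourier k t * (fourier n t * fourierCoeff (f : Torus → ℂ) n) =
      fourierCoeff (f : Torus → ℂ) n * (fourier (-(-k)) t • fourier n t) := by
    rw [neg_neg, smul_eq_mul]; ring
  simp only [h]
  rw [integral_const_mul]
  have h2 := congrFun (fourierCoeff_fourier (T := 2 * π) n) (-k)
  rw [fourierCoeff] at h2
  rw [h2]
  by_cases hn : n = -k
  · simp [hn]
  · rw [Pi.single_eq_of_ne hn, Pi.single_eq_of_ne (Ne.symm hn)]; simp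

theorem integral_trig_smul_translateLp_mem {p : ℝ≥0∞} [Fact (1 ≤ p)] (hp : p ≠ ∞) {f : LpTorus p}
    (hf : f ∈ hardySpace p) {g : C(Torus, ℂ)}
    (hg : g ∈ Submodule.span ℂ (Set.range (@fourier (2 * π)))) :
    ∫ t, g t • translateLp f t ∂haarAddCircle ∈ LinearMap.range (polyLpₗ p) := by
  have hint (g : C(Torus, ℂ)) : Integrable (fun t => g t • translateLp f t) haarAddCircle :=
    (g.continuous.smul (continuous_translateLp hp f)).integrable_of_hasCompactSupport
      (HasCompactSupport.of_compactSpace _)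
  induction hg using Submodule.span_induction with
  | mem g hg =>
    obtain ⟨k, rfl⟩ := hg
    rw [integral_fourier_smul_translateLp hp]
    rcases lt_or_ge (-k) 0 with hk | hk
    · rw [hf _ hk, zero_smul]; exact Submodule.zero_mem _
    · obtain ⟨m, hm⟩ := Int.eq_ofNat_of_zero_le hk
      refine Submodule.smul_mem _ _ ⟨Polynomial.X ^ m, ?_⟩
      rw [polyLpₗ_apply, polyLp, Polynomial.toAddCircle_X_pow_eq_fourier, hm]
  | zero => simp
  | add g₁ g₂ _ _ h₁ h₂ =>
    simp only [ContinuousMap.add_apply, add_smul]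
    rw [integral_add (hint g₁) (hint g₂)]
    exact Submodule.add_mem _ h₁ h₂
  | smul c g _ h =>
    simp only [ContinuousMap.smul_apply, smul_assoc]
    rw [integral_smul]
    exact Submodule.smul_mem _ _ h

/-- The nonnegative trigonometric polynomial `(1 + cos t) / 2`, which has a unique maximum. -/
noncomputable def peak (t : Torus) : ℝ := (1 + (fourier 1 t).re) / 2

theorem continuous_peak : Continuous peak := by
  unfold peak
  fun_prop

theorem peak_nonneg (t : Torus) : 0 ≤ peak t := by
  have := (abs_le.1 (Complex.abs_re_le_norm (fourier 1 t))).1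
  rw [norm_fourier_apply] at this
  unfold peak; linarith

theorem peak_zero : peak 0 = 1 := by
  unfold peak; rw [fourier_eval_zero]; norm_num

theorem peak_lt {t : Torus} (ht : t ≠ 0) : peak t < peak 0 := by
  rw [peak_zero]
  have h := Complex.re_le_norm (fourier 1 t)
  have hn := norm_fourier_apply 1 t
  rcases h.lt_or_eq with h | h
  · unfold peak; linarith
  · exfalso
    have h1 : fourier 1 t = 1 := by
      have him : (fourier 1 t).im = 0 := by
        have := Complex.sq_norm_sub_sq_re (fourier 1 t)
        rw [h, hn] at this
        simpa using this.symm
      apply Complex.ext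
      · rw [h, hn]; rfl
      · rw [him]; rfl
    rw [fourier_one] at h1
    refine ht (injective_toCircle (T := 2 * π) Real.two_pi_pos.ne' ?_)
    rw [toCircle_zero]
    exact Circle.ext h1

/-- `peak` as an element of the algebra of trigonometric polynomials. -/
noncomputable def peakC : C(Torus, ℂ) := ⟨fun t => (peak t : ℂ), by
  have := continuous_peak
  fun_prop⟩

theorem peakC_pow_mem (n : ℕ) :
    peakC ^ n ∈ Submodule.span ℂ (Set.range (@fourier (2 * π))) := by
  have h : peakC ∈ (@fourierSubalgebra (2 * π)).toSubalgebra := by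
    rw [← Subalgebra.mem_toSubmodule, fourierSubalgebra_coe]
    have : peakC = (1 / 2 : ℂ) • fourier 0 + (1 / 4 : ℂ) • (fourier 1 + fourier (-1)) := by
      ext t
      simp only [peakC, peak, ContinuousMap.coe_mk, ContinuousMap.add_apply,
        ContinuousMap.smul_apply, fourier_neg, fourier_zero, Complex.add_conj]
      push_cast
      simp only [smul_eq_mul]
      ring
    rw [this]
    have hm (k : ℤ) : fourier k ∈ Submodule.span ℂ (Set.range (@fourier (2 * π))) :=
      Submodule.subset_span ⟨k, rfl⟩
    exact Submodule.add_mem _ (Submodule.smul_mem _ _ (hm 0))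
      (Submodule.smul_mem _ _ (Submodule.add_mem _ (hm 1) (hm (-1))))
  rw [← fourierSubalgebra_coe, Subalgebra.mem_toSubmodule]
  exact pow_mem h n

theorem integral_peak_pow_pos (n : ℕ) : 0 < ∫ t, peak t ^ n ∂haarAddCircle := by
  refine (continuous_peak.pow n).integral_pos_of_hasCompactSupport_nonneg_nonzero (x := 0)
    (HasCompactSupport.of_compactSpace _) (fun t => pow_nonneg (peak_nonneg t) n) ?_
  simp [peak_zero]

/-- Analytic polynomials are dense in `H^p` for `p < ∞`. The approximants are averages of
translates, so they stay in every closed convex set which contains the translates. -/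
theorem exists_polyLp_tendsto {p : ℝ≥0∞} [Fact (1 ≤ p)] (hp : p ≠ ∞) {f : LpTorus p}
    (hf : f ∈ hardySpace p) :
    ∃ P : ℕ → Polynomial ℂ, Tendsto (fun n => polyLp p (P n)) atTop (𝓝 f) ∧
      ∀ S : Set (LpTorus p), Convex ℝ S → IsClosed S → (∀ t, translateLp f t ∈ S) →
        ∀ n, polyLp p (P n) ∈ S := by
  have hcoe (n : ℕ) : ∫ t, peak t ^ n • translateLp f t ∂haarAddCircle =
      ∫ t, (peakC ^ n) t • translateLp f t ∂haarAddCircle := by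
    refine integral_congr_ae (Eventually.of_forall fun t => ?_)
    simp only [peakC, ContinuousMap.pow_apply, ContinuousMap.coe_mk]
    rw [← Complex.ofReal_pow, Complex.coe_smul]
    rfl
  have hmem (n : ℕ) : ∃ P : Polynomial ℂ, polyLp p P =
      (∫ t, peak t ^ n ∂haarAddCircle)⁻¹ • ∫ t, peak t ^ n • translateLp f t ∂haarAddCircle := by
    obtain ⟨P, hP⟩ := Submodule.smul_mem _ (((∫ t, peak t ^ n ∂haarAddCircle)⁻¹ : ℝ) : ℂ)
      (integral_trig_smul_translateLp_mem hp hf (peakC_pow_mem n))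
    exact ⟨P, by rw [← polyLpₗ_apply, hP, hcoe, Complex.coe_smul]; rfl⟩
  choose P hP using hmem
  refine ⟨P, ?_, fun S hS hSc hfS n => ?_⟩
  · simp only [hP]
    -- The normalized powers of `peak` concentrate at `0`, and translation is continuous there.
    have := tendsto_setIntegral_pow_smul_of_unique_maximum_of_isCompact_of_continuousOn
      (μ := (haarAddCircle : Measure Torus)) (s := Set.univ) isCompact_univ
      continuous_peak.continuousOn (fun y _ hy => peak_lt hy) (fun x _ => peak_nonneg x)
      (by rw [peak_zero]; exact one_pos) (by simp) (continuous_translateLp hp f).continuousOn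
    simpa only [Measure.restrict_univ, translateLp_zero] using this
  · rw [hP]
    set c := ∫ t, peak t ^ n ∂haarAddCircle with hc
    have hc0 : 0 < c := integral_peak_pow_pos n
    -- The approximant is the mean of the translates for the probability measure with density `w`,
    -- so it stays in a closed convex set.
    set w : Torus → NNReal := fun t => (c⁻¹ * peak t ^ n).toNNReal with hw
    have hwm : Measurable w :=
      ((continuous_peak.pow n).const_smul c⁻¹).measurable.real_toNNReal
    have hwn (t : Torus) : 0 ≤ c⁻¹ * peak t ^ n :=
      mul_nonneg (inv_nonneg.2 hc0.le) (pow_nonneg (peak_nonneg t) n)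
    set ν := (haarAddCircle : Measure Torus).withDensity fun t => (w t : ℝ≥0∞) with hν
    have hint : Integrable (fun t => c⁻¹ * peak t ^ n) (haarAddCircle : Measure Torus) :=
      ((continuous_peak.pow n).const_smul c⁻¹).integrable_of_hasCompactSupport
        (HasCompactSupport.of_compactSpace _)
    have : IsProbabilityMeasure ν := by
      refine ⟨?_⟩
      rw [hν, withDensity_apply _ MeasurableSet.univ, Measure.restrict_univ]
      have := ofReal_integral_eq_lintegral_ofReal hint (Eventually.of_forall hwn)
      rw [integral_const_mul, ← hc, inv_mul_cancel₀ hc0.ne', ENNReal.ofReal_one] at this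
      exact this.symm
    have hval : ∫ t, translateLp f t ∂ν = c⁻¹ • ∫ t, peak t ^ n • translateLp f t ∂haarAddCircle := by
      rw [hν, integral_withDensity_eq_integral_smul hwm, ← integral_smul]
      refine integral_congr_ae (Eventually.of_forall fun t => ?_)
      simp only [NNReal.smul_def, hw, Real.coe_toNNReal _ (hwn t), mul_smul]
    rw [← hval]
    exact hS.integral_mem hSc (Eventually.of_forall hfS)
      ((continuous_translateLp hp f).integrable_of_hasCompactSupport
        (HasCompactSupport.of_compactSpace _))

/-! ### Exponentials of analytic functions -/

theorem ContinuousMap.exp_apply {X : Type*} [TopologicalSpace X] [CompactSpace X] (f : C(X, ℂ))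
    (x : X) : NormedSpace.exp f x = Complex.exp (f x) := by
  have h := NormedSpace.map_exp (ContinuousMap.evalAlgHom ℂ ℂ x)
    (continuous_eval_const x) f
  rw [Complex.exp_eq_exp_ℂ]
  exact h

/-- A Fourier coefficient is a continuous functional on `C(Torus, ℂ)`, so it can be applied term by
term to the exponential series of that Banach algebra. -/
theorem hasSum_fourierCoeff_exp (P : Polynomial ℂ) (n : ℤ) :
    HasSum (fun k : ℕ => ((k.factorial : ℂ)⁻¹) * fourierCoeff (P ^ k).toAddCircle n)
      (fourierCoeff (fun t => Complex.exp (P.toAddCircle t)) n) := by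
  let ℓ : C(Torus, ℂ) →L[ℂ] ℂ :=
    (fourierCoeffCLM 1 n).comp (ContinuousMap.toLp (E := ℂ) 1 haarAddCircle ℂ)
  have hℓ (g : C(Torus, ℂ)) : ℓ g = fourierCoeff g n := by
    change fourierCoeff (ContinuousMap.toLp (E := ℂ) 1 haarAddCircle ℂ g : Torus → ℂ) n = _
    rw [fourierCoeff_congr_ae (ContinuousMap.coeFn_toLp _ _)]
  have h := ℓ.hasSum (NormedSpace.exp_series_hasSum_exp' (𝕂 := ℂ) P.toAddCircle)
  simp only [← map_pow] at h
  convert! h using 1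
  · ext k
    rw [map_smul, hℓ, smul_eq_mul]
  · rw [hℓ]
    congr 1
    ext t
    rw [ContinuousMap.exp_apply]

theorem fourierCoeff_exp_of_neg (P : Polynomial ℂ) {n : ℤ} (hn : n < 0) :
    fourierCoeff (fun t => Complex.exp (P.toAddCircle t)) n = 0 := by
  refine (hasSum_fourierCoeff_exp P n).unique ?_
  simp only [Polynomial.fourierCoeff_toAddCircle_eq_zero_of_lt_zero _ _ hn, mul_zero]
  exact hasSum_zero

theorem fourierCoeff_exp_zero (P : Polynomial ℂ) :
    fourierCoeff (fun t => Complex.exp (P.toAddCircle t)) 0 = Complex.exp (P.coeff 0) := by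
  refine (hasSum_fourierCoeff_exp P 0).unique ?_
  have h (k : ℕ) : fourierCoeff (P ^ k).toAddCircle 0 = P.coeff 0 ^ k := by
    have := Polynomial.fourierCoeff_toAddCircle_natCast (P ^ k) 0
    rw [Nat.cast_zero, Polynomial.coeff_zero_eq_eval_zero, Polynomial.eval_pow,
      ← Polynomial.coeff_zero_eq_eval_zero] at this
    exact this
  simp only [h]
  rw [Complex.exp_eq_exp_ℂ]
  exact NormedSpace.exp_series_hasSum_exp' (𝕂 := ℂ) (P.coeff 0)

theorem ae_comp_add_left {p : Torus → Prop} (h : ∀ᵐ x ∂(haarAddCircle : Measure Torus), p x)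
    (t : Torus) : ∀ᵐ x ∂(haarAddCircle : Measure Torus), p (t + x) :=
  (measurePreserving_add_left haarAddCircle t).quasiMeasurePreserving.ae h

/-- Together with closedness, convexity lets the polynomial approximants of `F` inherit the bound
`Re F ≤ b`, which dominates their exponentials. -/
theorem convex_setOf_re_le (b : ℝ) :
    Convex ℝ {f : LpTorus 2 | ∀ᵐ t ∂(haarAddCircle : Measure Torus), (f t).re ≤ b} := by
  intro f hf g hg r s hr hs hrs
  filter_upwards [hf, hg, Lp.coeFn_add (r • f) (s • g), Lp.coeFn_smul r f, Lp.coeFn_smul s g]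
    with t h1 h2 h3 h4 h5
  rw [h3, Pi.add_apply, h4, h5, Pi.smul_apply, Pi.smul_apply, Complex.add_re, Complex.smul_re,
    Complex.smul_re, smul_eq_mul, smul_eq_mul]
  calc r * (f t).re + s * (g t).re ≤ r * b + s * b := by gcongr
    _ = b := by rw [← add_mul, hrs, one_mul]

theorem LpTorus.exists_subseq_tendsto_ae {p : ℝ≥0∞} [Fact (1 ≤ p)] {f : ℕ → LpTorus p}
    {g : LpTorus p} (h : Tendsto f atTop (𝓝 g)) : ∃ ns : ℕ → ℕ, StrictMono ns ∧
      ∀ᵐ t ∂(haarAddCircle : Measure Torus), Tendsto (fun n => f (ns n) t) atTop (𝓝 (g t)) :=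
  (tendstoInMeasure_of_tendsto_Lp h).exists_seq_tendsto_ae

theorem isClosed_setOf_re_le (b : ℝ) :
    IsClosed {f : LpTorus 2 | ∀ᵐ t ∂(haarAddCircle : Measure Torus), (f t).re ≤ b} := by
  refine IsSeqClosed.isClosed fun f g hf hfg => ?_
  obtain ⟨ns, -, hns⟩ := LpTorus.exists_subseq_tendsto_ae hfg
  filter_upwards [hns, ae_all_iff.2 hf] with t h1 h2
  exact le_of_tendsto ((Complex.continuous_re.tendsto _).comp h1)
    (Eventually.of_forall fun n => h2 (ns n))

/-- The exponential of a function in `H^2` with real part bounded above is a bounded analytic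
function, with the expected mean. -/
theorem fourierCoeff_exp_hardy {F : LpTorus 2} (hF : F ∈ hardySpace 2) {b : ℝ}
    (hb : ∀ᵐ t ∂(haarAddCircle : Measure Torus), (F t).re ≤ b) :
    (∀ n < 0, fourierCoeff (fun t => Complex.exp (F t)) n = 0) ∧
      fourierCoeff (fun t => Complex.exp (F t)) 0 =
        Complex.exp (fourierCoeff (F : Torus → ℂ) 0) := by
  obtain ⟨P, hP, hS⟩ := exists_polyLp_tendsto (by simp) hF
  have hPb := hS _ (convex_setOf_re_le b) (isClosed_setOf_re_le b) fun t => by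
    filter_upwards [coeFn_translateLp F t, ae_comp_add_left hb t] with x h1 h2
    rwa [h1]
  obtain ⟨ns, hmono, hns⟩ := LpTorus.exists_subseq_tendsto_ae hP
  have hlim (n : ℤ) : Tendsto
      (fun k => fourierCoeff (fun t => Complex.exp ((P (ns k)).toAddCircle t)) n) atTop
      (𝓝 (fourierCoeff (fun t => Complex.exp (F t)) n)) := by
    refine tendsto_integral_of_dominated_convergence (fun _ => Real.exp b) (fun k => ?_)
      (integrable_const _) (fun k => ?_) ?_
    · refine Continuous.aestronglyMeasurable ?_
      fun_prop
    · filter_upwards [coeFn_polyLp 2 (P (ns k)), hPb (ns k)] with t h1 h2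
      rw [norm_smul, norm_fourier_apply, one_mul, Complex.norm_exp, ← h1]
      exact Real.exp_le_exp.2 h2
    · filter_upwards [hns, ae_all_iff.2 fun k => coeFn_polyLp 2 (P (ns k))] with t h1 h2
      simp only [h2] at h1
      exact ((Complex.continuous_exp.tendsto _).comp h1).const_smul _
  constructor
  · intro n hn
    have := hlim n
    simp only [fourierCoeff_exp_of_neg _ hn] at this
    exact tendsto_nhds_unique this tendsto_const_nhds
  · have h1 := hlim 0
    simp only [fourierCoeff_exp_zero] at h1
    have h2 := (((fourierCoeffCLM 2 0).continuous.tendsto F).comp hP).comp hmono.tendsto_atTop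
    have h3 : Tendsto (fun k => (P (ns k)).coeff 0) atTop (𝓝 (fourierCoeff (F : Torus → ℂ) 0)) := by
      convert! h2 using 2 with k
      simp only [Function.comp_apply, fourierCoeffCLM_apply, fourierCoeff_polyLp]
      simp
    exact tendsto_nhds_unique h1 ((Complex.continuous_exp.tendsto _).comp h3)

/-- Every square integrable real function is the real part of a function in `H^2` with real mean. -/
theorem exists_hardy_re_eq {v : Torus → ℝ} (hv : MemLp (fun t => (v t : ℂ)) 2 haarAddCircle) :
    ∃ F ∈ hardySpace 2, (∀ᵐ t ∂(haarAddCircle : Measure Torus), (F t).re = v t) ∧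
      fourierCoeff (F : Torus → ℂ) 0 = ∫ t, (v t : ℂ) ∂haarAddCircle := by
  set V : Torus → ℂ := fun t => (v t : ℂ) with hV
  -- Doubling the positive frequencies and keeping the mean makes `F + conj F = 2 V`, since `V` is
  -- real.
  let c : ℤ → ℂ := fun n => if n < 0 then 0 else if n = 0 then 1 else 2
  have hc (n : ℤ) : ‖c n‖ ≤ 2 := by
    simp only [c]; split_ifs <;> norm_num
  let r := fourierBasis.repr (hv.toLp V)
  have hr (n : ℤ) : r n = fourierCoeff V n := by
    rw [fourierBasis_repr, fourierCoeff_congr_ae hv.coeFn_toLp]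
  have hmem : Memℓp (fun n => c n * r n) 2 := by
    refine ((lp.memℓp ((2 : ℂ) • r))).mono' ?_
    intro n
    rw [lp.coeFn_smul, Pi.smul_apply, norm_mul, norm_smul, Complex.norm_ofNat]
    gcongr
    exact hc n
  let F : LpTorus 2 := fourierBasis.repr.symm ⟨_, hmem⟩
  have hF (n : ℤ) : fourierCoeff (F : Torus → ℂ) n = c n * fourierCoeff V n := by
    rw [← fourierBasis_repr, LinearIsometryEquiv.apply_symm_apply, ← hr]
  have hVc (n : ℤ) : conj (fourierCoeff V (-n)) = fourierCoeff V n := by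
    rw [← fourierCoeff_conj]
    simp only [hV, Complex.conj_ofReal]
  refine ⟨F, fun n hn => ?_, ?_, ?_⟩
  · rw [hF]; simp [c, hn]
  · have hFi := LpTorus.integrable F
    have hFc : Integrable (fun t => conj (F t)) haarAddCircle :=
      (Complex.conjCLE.toContinuousLinearMap.integrable_comp hFi :)
    have hVi : Integrable V haarAddCircle := hv.integrable (by norm_num)
    have := ae_eq_of_fourierCoeff_eq (hFi.add hFc) (hVi.const_mul 2) fun n => by
      rw [fourierCoeff.add hFi hFc, Pi.add_apply, fourierCoeff_conj, fourierCoeff.const_mul, hF, hF,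
        map_mul, hVc]
      simp only [c]
      rcases lt_trichotomy n 0 with h | h | h
      · simp [h, h.ne, h.not_gt, map_ofNat]
      · subst h; norm_num; ring
      · simp [h, h.ne', h.not_gt]
    filter_upwards [this] with t ht
    have := congrArg Complex.re ht
    simp [hV] at this
    linarith
  · rw [hF, fourierCoeff_zero_eq_integral]
    simp [c]

/-- For a measurable set `E` there is an analytic `F` with real part the indicator of `E`, such that
all `exp (s F)`, `s ≥ 0`, are analytic. -/
theorem exists_exp_analytic {E : Set Torus} (hE : MeasurableSet E) :
    ∃ F : LpTorus 2,
      (∀ᵐ t ∂(haarAddCircle : Measure Torus), (F t).re = E.indicator (fun _ => (1 : ℝ)) t) ∧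
      ∀ s : ℝ, 0 ≤ s → (∀ n < 0, fourierCoeff (fun t => Complex.exp (s * F t)) n = 0) ∧
        fourierCoeff (fun t => Complex.exp (s * F t)) 0 =
          Real.exp (s * (haarAddCircle : Measure Torus).real E) := by
  have hv : MemLp (fun t => ((E.indicator (fun _ => (1 : ℝ)) t : ℝ) : ℂ)) 2
      (haarAddCircle : Measure Torus) := by
    refine MemLp.of_bound ?_ 1 (Eventually.of_forall fun t => ?_)
    · exact (Complex.measurable_ofReal.comp
        (measurable_const.indicator hE)).aestronglyMeasurable
    · by_cases h : t ∈ E <;> simp [h]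
  obtain ⟨F, hF, hre, hmean⟩ := exists_hardy_re_eq hv
  refine ⟨F, hre, fun s hs => ?_⟩
  have hsF : (s : ℂ) • F ∈ hardySpace 2 := Submodule.smul_mem _ _ hF
  have hcoe := Lp.coeFn_smul (s : ℂ) F
  have h := fourierCoeff_exp_hardy hsF (b := s) (by
    filter_upwards [hre, hcoe] with t h1 h2
    rw [h2, Pi.smul_apply, smul_eq_mul, Complex.re_ofReal_mul, h1]
    by_cases ht : t ∈ E <;> simp [ht, hs])
  have hexp : (fun t => Complex.exp (((s : ℂ) • F : LpTorus 2) t)) =ᵐ[haarAddCircle]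
      fun t => Complex.exp (s * F t) := by
    filter_upwards [hcoe] with t h2
    rw [h2, Pi.smul_apply, smul_eq_mul]
  rw [fourierCoeff_congr_ae hexp, fourierCoeff_congr_ae hcoe, fourierCoeff.const_smul, hmean,
    integral_complex_ofReal, integral_indicator_const _ hE] at h
  refine ⟨h.1, h.2.trans ?_⟩
  simp

theorem memLp_exp_of_re_eq_indicator {E : Set Torus} {F : LpTorus 2}
    (hF : ∀ᵐ t ∂(haarAddCircle : Measure Torus), (F t).re = E.indicator (fun _ => (1 : ℝ)) t)
    {s : ℝ} (hs : 0 ≤ s) (q : ℝ≥0∞) :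
    MemLp (fun t => Complex.exp (s * F t)) q (haarAddCircle : Measure Torus) := by
  refine MemLp.of_bound (Complex.continuous_exp.comp_aestronglyMeasurable
    ((Lp.aestronglyMeasurable F).const_mul _)) (Real.exp s) ?_
  filter_upwards [hF] with t ht
  rw [Complex.norm_exp, Complex.re_ofReal_mul, ht]
  refine Real.exp_le_exp.2 ?_
  by_cases h : t ∈ E <;> simp [h, hs]

/-! ### Nonvanishing almost everywhere -/

theorem exists_lowest_fourierCoeff {f : Torus → ℂ} (hf : Integrable f haarAddCircle)
    (hneg : ∀ n < 0, fourierCoeff f n = 0) (h0 : ¬ f =ᵐ[haarAddCircle] 0) :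
    ∃ n : ℕ, fourierCoeff f n ≠ 0 ∧ ∀ k : ℤ, k < n → fourierCoeff f k = 0 := by
  classical
  have hex : ∃ n : ℕ, fourierCoeff f n ≠ 0 := by
    by_contra! h
    refine h0 (ae_eq_zero_of_fourierCoeff_eq_zero hf fun n => ?_)
    rcases lt_or_ge n 0 with hn | hn
    · exact hneg n hn
    · obtain ⟨m, rfl⟩ := Int.eq_ofNat_of_zero_le hn
      exact h m
  refine ⟨Nat.find hex, Nat.find_spec hex, fun k hk => ?_⟩
  rcases lt_or_ge k 0 with hn | hn
  · exact hneg k hn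
  · obtain ⟨m, rfl⟩ := Int.eq_ofNat_of_zero_le hn
    by_contra h
    exact absurd (Nat.find_min' hex h) (by omega)

/-- A nonzero function in `H^2` is nonzero almost everywhere. -/
theorem ae_ne_zero_of_mem_hardySpace {f : LpTorus 2} (hf : f ∈ hardySpace 2) (h0 : f ≠ 0) :
    ∀ᵐ t ∂(haarAddCircle : Measure Torus), f t ≠ 0 := by
  have hE : MeasurableSet {t | f t = 0} :=
    (Lp.stronglyMeasurable f).measurable (measurableSet_singleton 0)
  set E := {t | f t = 0}
  obtain ⟨k, hk, hlow⟩ := exists_lowest_fourierCoeff (LpTorus.integrable f) hf fun h =>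
    h0 ((Lp.eq_zero_iff_ae_eq_zero).2 h)
  obtain ⟨F, hre, hF⟩ := exists_exp_analytic hE
  by_contra hpos
  have hm : 0 < (haarAddCircle : Measure Torus).real E := by
    refine ENNReal.toReal_pos (fun h => hpos ?_) (measure_ne_top _ _)
    rw [ae_iff]
    simpa using h
  -- The factor `exp (s F)` has modulus one off `E`, and `f` vanishes on `E`, so `|f|` is unchanged;
  -- yet the lowest coefficient of `f` is multiplied by `exp (s m(E))`, which is unbounded in `s`.
  have hbound (s : ℝ) (hs : 0 ≤ s) : ‖fourierCoeff (f : Torus → ℂ) k‖ *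
      Real.exp (s * (haarAddCircle : Measure Torus).real E) ≤ ∫ t, ‖f t‖ ∂haarAddCircle := by
    have h1 := fourierCoeff_mul_of_lowest (Lp.memLp f) (memLp_exp_of_re_eq_indicator hre hs 2) hlow
      (hF s hs).1
    have h2 := norm_fourierCoeff_le (fun t => f t * Complex.exp (s * F t)) k
    rw [h1, (hF s hs).2, norm_mul, Complex.norm_real, Real.norm_of_nonneg (Real.exp_pos _).le] at h2
    refine h2.trans_eq (integral_congr_ae ?_)
    filter_upwards [hre] with t ht
    by_cases hz : t ∈ E
    · have : f t = 0 := hz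
      simp [this]
    · simp [Complex.norm_exp, ht, hz]
  have hlim : Tendsto (fun s : ℝ => ‖fourierCoeff (f : Torus → ℂ) k‖ *
      Real.exp (s * (haarAddCircle : Measure Torus).real E)) atTop atTop :=
    (Real.tendsto_exp_atTop.comp (tendsto_id.atTop_mul_const hm)).const_mul_atTop (norm_pos_iff.2 hk)
  obtain ⟨s, hs, hs'⟩ := ((eventually_ge_atTop 0).and
    (hlim.eventually_gt_atTop (∫ t, ‖f t‖ ∂haarAddCircle))).exists
  exact absurd (hbound s hs) hs'.not_ge

/-- The same for functions of `H^p` which are square integrable. -/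
theorem ae_ne_zero_of_mem_hardySpace_of_memLp {p : ℝ≥0∞} [Fact (1 ≤ p)] {f : LpTorus p}
    (hf : f ∈ hardySpace p) (h0 : f ≠ 0) (h2 : MemLp f 2 (haarAddCircle : Measure Torus)) :
    ∀ᵐ t ∂(haarAddCircle : Measure Torus), f t ≠ 0 := by
  have h := ae_ne_zero_of_mem_hardySpace (f := h2.toLp f)
    (fun n hn => by rw [fourierCoeff_congr_ae h2.coeFn_toLp, hf n hn]) fun h => h0 (by
      rw [Lp.eq_zero_iff_ae_eq_zero] at h ⊢
      exact h2.coeFn_toLp.symm.trans h)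
  filter_upwards [h, h2.coeFn_toLp] with t h1 h3
  rwa [h3] at h1

/-! ### The pairing, and square integrability of Hilbert points -/

theorem pairing_congr_ae {f f' g g' : Torus → ℂ} (hf : f =ᵐ[haarAddCircle] f')
    (hg : g =ᵐ[haarAddCircle] g') : pairing f g = pairing f' g' := by
  refine integral_congr_ae ?_
  filter_upwards [hf, hg] with t h1 h2
  rw [h1, h2]

theorem pairing_fourier (k : ℤ) (φ : Torus → ℂ) :
    pairing (fourier k) φ = conj (fourierCoeff φ k) := by
  rw [fourierCoeff, ← integral_conj]
  refine integral_congr_ae (Eventually.of_forall fun t => ?_)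
  simp only [smul_eq_mul, map_mul, ← fourier_neg, neg_neg]

theorem integrable_toAddCircle_mul_conj {φ : Torus → ℂ} (hφ : Integrable φ haarAddCircle)
    (P : Polynomial ℂ) : Integrable (fun t => P.toAddCircle t * conj (φ t)) haarAddCircle :=
  (Complex.conjCLE.toContinuousLinearMap.integrable_comp hφ).bdd_mul (c := ‖P.toAddCircle‖)
    P.toAddCircle.continuous.aestronglyMeasurable
    (Eventually.of_forall P.toAddCircle.norm_coe_le_norm)

/-- The pairing of an analytic polynomial with an integrable function, as a functional. -/
noncomputable def polyPairing {φ : Torus → ℂ} (hφ : Integrable φ haarAddCircle) :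
    Polynomial ℂ →ₗ[ℂ] ℂ where
  toFun P := pairing P.toAddCircle φ
  map_add' P Q := by
    simp only [pairing, map_add, ContinuousMap.add_apply, add_mul]
    exact integral_add (integrable_toAddCircle_mul_conj hφ P) (integrable_toAddCircle_mul_conj hφ Q)
  map_smul' c P := by
    simp only [pairing, map_smul, ContinuousMap.smul_apply, smul_eq_mul, mul_assoc, RingHom.id_apply]
    exact integral_const_mul _ _

theorem polyPairing_apply {φ : Torus → ℂ} (hφ : Integrable φ haarAddCircle) (P : Polynomial ℂ) :
    polyPairing hφ P = pairing P.toAddCircle φ := rfl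

theorem pairing_polyLp {φ : Torus → ℂ} (hφ : Integrable φ haarAddCircle) (p : ℝ≥0∞) [Fact (1 ≤ p)]
    (P : Polynomial ℂ) : pairing (polyLp p P) φ = polyPairing hφ P :=
  pairing_congr_ae (coeFn_polyLp p P) (ae_eq_refl φ)

theorem polyPairing_monomial {φ : Torus → ℂ} (hφ : Integrable φ haarAddCircle) (n : ℕ) (c : ℂ) :
    polyPairing hφ (Polynomial.monomial n c) = c * conj (fourierCoeff φ n) := by
  rw [polyPairing_apply, Polynomial.toAddCircle_monomial_eq_smul_fourier, ← pairing_fourier, pairing,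
    pairing, ← integral_const_mul]
  simp only [ContinuousMap.smul_apply, smul_eq_mul, mul_assoc]

theorem inner_eq_pairing (f g : LpTorus 2) : inner ℂ f g = pairing g f := by
  rw [L2.inner_def]
  refine integral_congr_ae (Eventually.of_forall fun t => ?_)
  simp only [RCLike.inner_apply]

theorem norm_polyLp_le {p : ℝ≥0∞} [Fact (1 ≤ p)] (hp : p ≤ 2) (P : Polynomial ℂ) :
    ‖polyLp p P‖ ≤ ‖polyLp 2 P‖ := by
  rw [Lp.norm_def, Lp.norm_def, eLpNorm_congr_ae (coeFn_polyLp p P),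
    ← eLpNorm_congr_ae (coeFn_polyLp 2 P)]
  exact ENNReal.toReal_mono (Lp.eLpNorm_ne_top _)
    (eLpNorm_le_eLpNorm_of_exponent_le hp (Lp.aestronglyMeasurable _))

/-- For square integrable functions the literal orthogonality relation implies the relation by
approximation. -/
theorem mem_closure_of_pairing_eq_zero {p : ℝ≥0∞} [Fact (1 ≤ p)] (hp : p < 2) {f φ : LpTorus p}
    (hφ : φ ∈ hardySpace p) (hφ0 : φ ≠ 0) (hφ2 : MemLp φ 2 (haarAddCircle : Measure Torus))
    (hf : f ∈ hardySpace p) (hf2 : MemLp f 2 (haarAddCircle : Measure Torus))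
    (hfφ : pairing f φ = 0) :
    f ∈ closure {g : LpTorus p | ∃ P : Polynomial ℂ, g = polyLp p P ∧ pairing g φ = 0} := by
  have hφi := LpTorus.integrable φ
  have hf2' : hf2.toLp f ∈ hardySpace 2 := fun n hn => by
    rw [fourierCoeff_congr_ae hf2.coeFn_toLp, hf n hn]
  obtain ⟨P, hP, -⟩ := exists_polyLp_tendsto (by simp) hf2'
  obtain ⟨k, hk, -⟩ := exists_lowest_fourierCoeff hφi hφ fun h =>
    hφ0 ((Lp.eq_zero_iff_ae_eq_zero).2 h)
  have hL : Tendsto (fun n => polyPairing hφi (P n)) atTop (𝓝 0) := by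
    have h := ((innerSL ℂ (hφ2.toLp φ)).continuous.tendsto _).comp hP
    simp only [innerSL_apply_apply, inner_eq_pairing] at h
    rw [pairing_congr_ae hf2.coeFn_toLp hφ2.coeFn_toLp, hfφ] at h
    convert! h using 2 with n
    simp only [Function.comp_apply, innerSL_apply_apply, inner_eq_pairing]
    rw [pairing_congr_ae (ae_eq_refl _) hφ2.coeFn_toLp, pairing_polyLp hφi]
  -- A fixed polynomial of pairing one with `φ`: subtracting multiples of it moves `P n` into the
  -- kernel, and the multiples tend to zero.
  set e : Polynomial ℂ := Polynomial.monomial k (conj (fourierCoeff (φ : Torus → ℂ) k))⁻¹ with he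
  have hLe : polyPairing hφi e = 1 := by
    rw [he, polyPairing_monomial, inv_mul_cancel₀ (by simpa using hk)]
  set Q : ℕ → Polynomial ℂ := fun n => P n - polyPairing hφi (P n) • e with hQ
  have hQlim : Tendsto (fun n => polyLp 2 (Q n)) atTop (𝓝 (hf2.toLp f)) := by
    have h : Tendsto (fun n => polyLpₗ 2 (P n) - polyPairing hφi (P n) • polyLpₗ 2 e) atTop
        (𝓝 (hf2.toLp f - (0 : ℂ) • polyLpₗ 2 e)) := hP.sub (hL.smul_const _)
    rw [zero_smul, sub_zero] at h
    refine h.congr fun n => ?_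
    rw [← polyLpₗ_apply, map_sub, map_smul]
  have hQlim' : Tendsto (fun n => polyLp p (Q n)) atTop (𝓝 f) := by
    rw [Lp.tendsto_Lp_iff_tendsto_eLpNorm'] at hQlim ⊢
    refine tendsto_of_tendsto_of_tendsto_of_le_of_le tendsto_const_nhds hQlim
      (fun _ => zero_le) fun n => ?_
    have h : (polyLp p (Q n) : Torus → ℂ) - (f : Torus → ℂ) =ᵐ[haarAddCircle]
        (polyLp 2 (Q n) : Torus → ℂ) - (hf2.toLp f : Torus → ℂ) :=
      ((coeFn_polyLp p (Q n)).trans (coeFn_polyLp 2 (Q n)).symm).sub hf2.coeFn_toLp.symm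
    dsimp only
    rw [eLpNorm_congr_ae h]
    exact eLpNorm_le_eLpNorm_of_exponent_le hp.le
      ((Lp.aestronglyMeasurable _).sub (Lp.aestronglyMeasurable _))
  refine mem_closure_of_tendsto hQlim' (Eventually.of_forall fun n => ⟨Q n, rfl, ?_⟩)
  rw [pairing_polyLp hφi, hQ, map_sub, map_smul, hLe, smul_eq_mul, mul_one, sub_self]

/-- A Hilbert point for `p < 2` pairs boundedly with analytic polynomials: otherwise the kernel of
the pairing would be dense. -/
theorem IsHilbertPoint.exists_norm_polyPairing_le {p : ℝ≥0∞} [Fact (1 ≤ p)] (hp : p < 2)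
    {φ : LpTorus p} (h : IsHilbertPoint φ) : ∃ C : ℝ, ∀ P : Polynomial ℂ,
      ‖polyPairing (LpTorus.integrable φ) P‖ ≤ C * ‖polyLp p P‖ := by
  obtain ⟨hφ, hφ0, hmin⟩ := h
  set L := polyPairing (LpTorus.integrable φ) with hL
  by_contra! hC
  choose P hP using fun n : ℕ => hC n
  have hpos (n : ℕ) : 0 < ‖L (P n)‖ := lt_of_le_of_lt (by positivity) (hP n)
  set R : ℕ → Polynomial ℂ := fun n => (L (P n))⁻¹ • P n with hR
  have hLR (n : ℕ) : L (R n) = 1 := by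
    rw [hR, map_smul, smul_eq_mul, inv_mul_cancel₀ (norm_pos_iff.1 (hpos n))]
  have hRlim : Tendsto (fun n => polyLpₗ p (R n)) atTop (𝓝 0) := by
    refine squeeze_zero_norm' ?_ tendsto_inv_atTop_nhds_zero_nat
    filter_upwards [eventually_gt_atTop 0] with n hn
    have hn' : (0 : ℝ) < n := Nat.cast_pos.2 hn
    rw [hR, map_smul, norm_smul, norm_inv, polyLpₗ_apply, inv_mul_le_iff₀ (hpos n),
      ← div_eq_mul_inv, le_div_iff₀ hn', mul_comm]
    exact (hP n).le
  set N := {g : LpTorus p | ∃ P : Polynomial ℂ, g = polyLp p P ∧ pairing g φ = 0} with hN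
  have hpoly (S : Polynomial ℂ) : polyLp p S ∈ closure N := by
    have h1 : Tendsto (fun n => polyLpₗ p S - L S • polyLpₗ p (R n)) atTop
        (𝓝 (polyLpₗ p S - L S • 0)) := tendsto_const_nhds.sub (hRlim.const_smul _)
    rw [smul_zero, sub_zero] at h1
    refine mem_closure_of_tendsto h1 (Eventually.of_forall fun n => ⟨S - L S • R n, ?_, ?_⟩)
    · rw [← polyLpₗ_apply, map_sub, map_smul _ (L S)]
    · rw [← map_smul, ← map_sub, polyLpₗ_apply, pairing_polyLp (LpTorus.integrable φ), map_sub,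
        map_smul, hLR, smul_eq_mul, mul_one, sub_self]
  have hneg : -φ ∈ hardySpace p := Submodule.neg_mem _ hφ
  obtain ⟨S, hS, -⟩ := exists_polyLp_tendsto (hp.trans (by simp)).ne hneg
  have hmem : -φ ∈ closure N :=
    isClosed_closure.mem_of_tendsto hS (Eventually.of_forall fun n => hpoly (S n))
  have := hmin (-φ) hneg ⟨fun h2 => absurd hp (not_lt.2 h2), fun _ => hmem⟩
  rw [add_neg_cancel, norm_zero] at this
  exact hφ0 (norm_le_zero_iff.1 this)

theorem polyLp_monomial {p : ℝ≥0∞} [Fact (1 ≤ p)] (n : ℕ) (c : ℂ) :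
    polyLp p (Polynomial.monomial n c) = c • fourierLp p n := by
  rw [polyLp, Polynomial.toAddCircle_monomial_eq_smul_fourier, map_smul]

/-- A function in `H^p` with bounded pairing with analytic polynomials is square integrable. -/
theorem memLp_two_of_norm_polyPairing_le {p : ℝ≥0∞} [Fact (1 ≤ p)] (hp : p ≤ 2) {φ : LpTorus p}
    (hφ : φ ∈ hardySpace p) {C : ℝ}
    (hC : ∀ P : Polynomial ℂ, ‖polyPairing (LpTorus.integrable φ) P‖ ≤ C * ‖polyLp p P‖) :
    MemLp φ 2 (haarAddCircle : Measure Torus) := by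
  set a : ℤ → ℂ := fourierCoeff (φ : Torus → ℂ) with ha
  have hbound (s : Finset ℤ) : ∑ i ∈ s, ‖a i‖ ^ 2 ≤ C ^ 2 := by
    set u := s.filter (0 ≤ ·) with hu
    have hsum : ∑ i ∈ s, ‖a i‖ ^ 2 = ∑ i ∈ u, ‖a i‖ ^ 2 := by
      refine (Finset.sum_filter_of_ne fun i _ hi => ?_).symm
      by_contra hneg
      exact hi (by rw [ha, hφ i (not_le.1 hneg)]; simp)
    have hnat {i : ℤ} (hi : i ∈ u) : ((i.natAbs : ℕ) : ℤ) = i :=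
      Int.natAbs_of_nonneg (Finset.mem_filter.1 hi).2
    set σ := ∑ i ∈ u, ‖a i‖ ^ 2 with hσ
    have hσ0 : 0 ≤ σ := Finset.sum_nonneg fun i _ => by positivity
    -- A truncation of the Fourier series of `φ`: its pairing with `φ` and its squared `L²` norm are
    -- both `σ`, so the bound reads `σ ≤ C √σ`.
    set P : Polynomial ℂ := ∑ i ∈ u, Polynomial.monomial i.natAbs (a i) with hP
    have h1 : polyPairing (LpTorus.integrable φ) P = (σ : ℂ) := by
      rw [hP, map_sum, hσ, Complex.ofReal_sum]
      refine Finset.sum_congr rfl fun i hi => ?_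
      rw [polyPairing_monomial, hnat hi, ← ha, Complex.mul_conj, Complex.normSq_eq_norm_sq]
    have h2 : ‖polyLp 2 P‖ ^ 2 = σ := by
      have : polyLp 2 P = ∑ i ∈ u, a i • fourierLp 2 i := by
        rw [← polyLpₗ_apply, hP, map_sum]
        refine Finset.sum_congr rfl fun i hi => ?_
        rw [polyLpₗ_apply, polyLp_monomial, hnat hi]
      have h3 := inner_self_eq_norm_sq_to_K (𝕜 := ℂ) (polyLp 2 P)
      rw [this, orthonormal_fourier.inner_sum] at h3
      rw [this]
      have h4 : (((‖∑ i ∈ u, a i • (fourierLp 2 i : LpTorus 2)‖ ^ 2 : ℝ)) : ℂ) = (σ : ℂ) := by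
        push_cast
        refine h3.symm.trans ?_
        rw [hσ, Complex.ofReal_sum]
        refine Finset.sum_congr rfl fun i _ => ?_
        rw [mul_comm, Complex.mul_conj, Complex.normSq_eq_norm_sq]
      exact_mod_cast h4
    have h3 := hC P
    rw [h1, Complex.norm_real, Real.norm_of_nonneg hσ0] at h3
    rw [hsum]
    rcases hσ0.eq_or_lt with h0 | hpos
    · rw [← h0]; positivity
    · have hn : 0 < ‖polyLp 2 P‖ := by
        by_contra hn
        rw [le_antisymm (not_lt.1 hn) (norm_nonneg _)] at h2
        norm_num at h2
        exact hpos.ne h2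
      have hCn : 0 < C := by
        by_contra hCn
        have := mul_nonpos_of_nonpos_of_nonneg (not_lt.1 hCn) (norm_nonneg (polyLp p P))
        linarith
      have h4 : σ ≤ C * ‖polyLp 2 P‖ := h3.trans (by gcongr; exact norm_polyLp_le hp P)
      rw [← h2] at h4 ⊢
      have h5 : ‖polyLp 2 P‖ ≤ C := by
        rw [sq] at h4
        exact le_of_mul_le_mul_right h4 hn
      gcongr
  have hmem : Memℓp a 2 := memℓp_gen' (C := C ^ 2) fun s => by
    simpa using hbound s
  let Φ : LpTorus 2 := fourierBasis.repr.symm ⟨a, hmem⟩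
  have hΦ : (φ : Torus → ℂ) =ᵐ[haarAddCircle] Φ :=
    ae_eq_of_fourierCoeff_eq (LpTorus.integrable φ) (LpTorus.integrable Φ) fun n => by
      rw [← fourierBasis_repr, LinearIsometryEquiv.apply_symm_apply]
  exact (memLp_congr_ae hΦ).2 (Lp.memLp Φ)

theorem IsHilbertPoint.memLp_two {p : ℝ≥0∞} [Fact (1 ≤ p)] {φ : LpTorus p}
    (h : IsHilbertPoint φ) : MemLp φ 2 (haarAddCircle : Measure Torus) := by
  rcases lt_or_ge p 2 with hp | hp
  · obtain ⟨C, hC⟩ := h.exists_norm_polyPairing_le hp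
    exact memLp_two_of_norm_polyPairing_le hp.le h.1 hC
  · exact (Lp.memLp φ).mono_exponent hp

theorem integral_norm_sq_pos {p : ℝ≥0∞} [Fact (1 ≤ p)] {φ : LpTorus p} (h0 : φ ≠ 0)
    (h2 : MemLp φ 2 (haarAddCircle : Measure Torus)) :
    0 < ∫ t, ‖φ t‖ ^ 2 ∂haarAddCircle := by
  rw [integral_pos_iff_support_of_nonneg (fun t => by positivity) (h2.integrable_norm_pow two_ne_zero)]
  by_contra h
  refine h0 ((Lp.eq_zero_iff_ae_eq_zero).2 ?_)
  have h' := nonpos_iff_eq_zero.1 (not_lt.1 h)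
  rw [Filter.EventuallyEq, ae_iff]
  convert h' using 2
  ext t
  simp

/-! ### The variational inequality -/

/-- Multiplying a Hilbert point by a bounded analytic function, and renormalizing the component
along the Hilbert point, does not decrease the norm. -/
theorem IsHilbertPoint.norm_mul_le {p : ℝ≥0∞} [Fact (1 ≤ p)] {φ : LpTorus p}
    (h : IsHilbertPoint φ) {H : Torus → ℂ} (hH : MemLp H ∞ haarAddCircle)
    (hneg : ∀ n < 0, fourierCoeff H n = 0) :
    ‖φ‖ * ‖∫ t, H t * (‖φ t‖ ^ 2 : ℝ) ∂haarAddCircle‖ ≤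
      (eLpNorm (fun t => φ t * H t) p haarAddCircle).toReal * ∫ t, ‖φ t‖ ^ 2 ∂haarAddCircle := by
  have h2 := h.memLp_two
  obtain ⟨hφ, hφ0, hmin⟩ := h
  have hB := integral_norm_sq_pos hφ0 h2
  set B := ∫ t, ‖φ t‖ ^ 2 ∂haarAddCircle with hBdef
  set A := ∫ t, H t * (‖φ t‖ ^ 2 : ℝ) ∂haarAddCircle with hA
  by_cases hA0 : A = 0
  · rw [hA0, norm_zero, mul_zero]
    exact mul_nonneg ENNReal.toReal_nonneg hB.le
  have hG {q : ℝ≥0∞} (hq : MemLp φ q haarAddCircle) :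
      MemLp (fun t => φ t * H t) q haarAddCircle := hH.mul hq
  -- With this factor `⟨c G, φ⟩ = c A = B = ⟨φ, φ⟩`.
  set c : ℂ := B / A with hc
  set G : LpTorus p := (hG (Lp.memLp φ)).toLp _ with hGdef
  have hGcoe : (G : Torus → ℂ) =ᵐ[haarAddCircle] fun t => φ t * H t := MemLp.coeFn_toLp _
  have hGmem : G ∈ hardySpace p := fun n hn => by
    rw [fourierCoeff_congr_ae hGcoe]
    exact fourierCoeff_mul_of_neg h2 (hH.mono_exponent le_top) hφ hneg hn
  set f : LpTorus p := c • G - φ with hf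
  have hfmem : f ∈ hardySpace p := Submodule.sub_mem _ (Submodule.smul_mem _ _ hGmem) hφ
  have hfcoe : (f : Torus → ℂ) =ᵐ[haarAddCircle] fun t => c * (φ t * H t) - φ t := by
    filter_upwards [Lp.coeFn_sub (c • G) φ, Lp.coeFn_smul c G, hGcoe] with t h1 h3 h4
    rw [h1, Pi.sub_apply, h3, Pi.smul_apply, h4, smul_eq_mul]
  have hint : Integrable (fun t => ‖φ t‖ ^ 2) haarAddCircle := h2.integrable_norm_pow two_ne_zero
  have hfpair : pairing f φ = 0 := by
    have h3 : pairing f φ =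
        ∫ t, (c * (H t * (‖φ t‖ ^ 2 : ℝ)) - ((‖φ t‖ ^ 2 : ℝ) : ℂ)) ∂haarAddCircle := by
      refine integral_congr_ae ?_
      filter_upwards [hfcoe] with t ht
      rw [ht, ← Complex.normSq_eq_norm_sq, ← Complex.mul_conj]
      ring
    rw [h3, integral_sub, integral_const_mul, integral_complex_ofReal, ← hA, ← hBdef, hc,
      div_mul_cancel₀ _ hA0, sub_self]
    · refine Integrable.const_mul ?_ _
      exact (hint.ofReal (𝕜 := ℂ)).mul_of_top_right hH
    · exact hint.ofReal
  have hf2 : MemLp f 2 haarAddCircle :=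
    (memLp_congr_ae hfcoe).2 (((hG h2).const_mul c).sub h2)
  have hle := hmin f hfmem ⟨fun _ => hfpair, fun hp =>
    mem_closure_of_pairing_eq_zero hp hφ hφ0 h2 hfmem hf2 hfpair⟩
  rw [hf, add_sub_cancel, norm_smul, hc, norm_div, Complex.norm_real, Real.norm_of_nonneg hB.le,
    div_mul_eq_mul_div, le_div_iff₀ (norm_pos_iff.2 hA0)] at hle
  refine hle.trans_eq ?_
  rw [mul_comm, Lp.norm_def, eLpNorm_congr_ae hGcoe]

/-! ### First variation for finite `p` -/

/-- With `|1 + z|² = 1 + x`, the power is at most `exp (q x / 2)`, which is expanded to second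
order. The bound on `ε` keeps `|q x / 2| ≤ 5 / 8`; the quadratic errors are at most `25 / 16 + 1 / 2
< 3` times `q² ε²`. -/
theorem norm_one_add_rpow_le {q : ℝ} (hq : 1 ≤ q) {z : ℂ} {ε : ℝ} (hz : ‖z‖ ≤ ε)
    (hε : ε ≤ 1 / (2 * q)) : ‖1 + z‖ ^ q ≤ 1 + q * z.re + 3 * q ^ 2 * ε ^ 2 := by
  have hε0 : 0 ≤ ε := (norm_nonneg z).trans hz
  have hqε : q * ε ≤ 1 / 2 := by
    calc q * ε ≤ q * (1 / (2 * q)) := by gcongr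
      _ = 1 / 2 := by field_simp
  have hε1 : ε ≤ 1 / 2 := by nlinarith
  have hre : |z.re| ≤ ε := (Complex.abs_re_le_norm z).trans hz
  have hsq : ‖z‖ ^ 2 ≤ ε ^ 2 := by gcongr
  set x := 2 * z.re + ‖z‖ ^ 2 with hx
  have hnorm : ‖1 + z‖ ^ 2 = 1 + x := by
    rw [hx, Complex.sq_norm, Complex.sq_norm, Complex.normSq_apply, Complex.normSq_apply]
    simp only [Complex.add_re, Complex.one_re, Complex.add_im, Complex.one_im]
    ring
  have hxabs : |x| ≤ 5 / 2 * ε := by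
    rw [abs_le] at hre ⊢
    constructor <;> nlinarith [sq_nonneg ‖z‖]
  have h1 : ‖1 + z‖ ^ q = (1 + x) ^ (q / 2) := by
    rw [← hnorm, ← Real.rpow_natCast, ← Real.rpow_mul (norm_nonneg _)]
    congr 1; push_cast; ring
  have hy : |q / 2 * x| ≤ 5 / 4 * (q * ε) := by
    rw [abs_mul, abs_of_nonneg (by positivity)]
    calc q / 2 * |x| ≤ q / 2 * (5 / 2 * ε) := by gcongr
      _ = 5 / 4 * (q * ε) := by ring
  have h2 : (1 + x) ^ (q / 2) ≤ Real.exp (q / 2 * x) := by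
    have h0 : 0 ≤ 1 + x := hnorm ▸ by positivity
    calc (1 + x) ^ (q / 2) ≤ (Real.exp x) ^ (q / 2) := by
          gcongr
          linarith [Real.add_one_le_exp x]
      _ = Real.exp (q / 2 * x) := by rw [← Real.exp_mul, mul_comm]
  have h3 := (abs_le.1 (Real.abs_exp_sub_one_sub_id_le (x := q / 2 * x) (by linarith))).2
  have h4 : (q / 2 * x) ^ 2 ≤ (5 / 4 * (q * ε)) ^ 2 := sq_le_sq' (abs_le.1 hy).1 (abs_le.1 hy).2
  have h5 : q / 2 * ‖z‖ ^ 2 ≤ q ^ 2 / 2 * ε ^ 2 := by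
    calc q / 2 * ‖z‖ ^ 2 ≤ q / 2 * ε ^ 2 := by gcongr
      _ ≤ q ^ 2 / 2 * ε ^ 2 := by gcongr; nlinarith
  rw [h1]
  have h6 : q / 2 * x = q * z.re + q / 2 * ‖z‖ ^ 2 := by rw [hx]; ring
  nlinarith [sq_nonneg (q * ε)]

theorem le_of_forall_small_linear {a b K r : ℝ} (hr : 0 < r)
    (h : ∀ ε, 0 < ε → ε ≤ r → 1 + ε * a ≤ 1 + ε * b + K * ε ^ 2) : a ≤ b := by
  have hlim : Tendsto (fun ε : ℝ => b + K * ε) (𝓝[>] 0) (𝓝 (b + K * 0)) := by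
    have : Continuous fun ε : ℝ => b + K * ε := by fun_prop
    exact (this.tendsto 0).mono_left nhdsWithin_le_nhds
  rw [mul_zero, add_zero] at hlim
  refine ge_of_tendsto hlim ?_
  filter_upwards [Ioc_mem_nhdsGT hr] with ε hε
  have := h ε hε.1 hε.2
  have h2 : ε * a ≤ ε * (b + K * ε) := by nlinarith
  exact le_of_mul_le_mul_left h2 hε.1

theorem integrable_fourier_mul_ofReal {u : Torus → ℝ} (hu : Integrable u haarAddCircle) (n : ℤ) :
    Integrable (fun t => fourier n t * (u t : ℂ)) haarAddCircle :=
  Integrable.fourier_smul (hu.ofReal (𝕜 := ℂ)) n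

/-- The first variation of the norm at a Hilbert point in the direction `φ (w z ^ n - c)` compares
the Fourier coefficients of the normalized densities `|φ|^p` and `|φ|^2`. -/
theorem IsHilbertPoint.re_mul_coeff_le {p : ℝ≥0∞} [hp1 : Fact (1 ≤ p)] (hp : p ≠ ∞) {φ : LpTorus p}
    (h : IsHilbertPoint φ) (n : ℕ) {w : ℂ} (hw : ‖w‖ = 1) :
    (w * ∫ t, fourier n t * (‖φ t‖ ^ 2 : ℝ) ∂haarAddCircle).re / ∫ t, ‖φ t‖ ^ 2 ∂haarAddCircle ≤
      (w * ∫ t, fourier n t * (‖φ t‖ ^ p.toReal : ℝ) ∂haarAddCircle).re /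
        ∫ t, ‖φ t‖ ^ p.toReal ∂haarAddCircle := by
  have hφ0 := h.2.1
  have h2 := h.memLp_two
  have hp0 : p ≠ 0 := (zero_lt_one.trans_le hp1.out).ne'
  set q := p.toReal with hq
  have hq1 : 1 ≤ q := by
    rw [hq, ← ENNReal.toReal_one]
    exact ENNReal.toReal_mono hp hp1.out
  have hq0 : 0 < q := by linarith
  have hB := integral_norm_sq_pos hφ0 h2
  set B := ∫ t, ‖φ t‖ ^ 2 ∂haarAddCircle with hBdef
  set N := ∫ t, ‖φ t‖ ^ q ∂haarAddCircle with hNdef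
  have hBi : Integrable (fun t => ‖φ t‖ ^ 2) haarAddCircle := h2.integrable_norm_pow two_ne_zero
  have hNi : Integrable (fun t => ‖φ t‖ ^ q) haarAddCircle :=
    (Lp.memLp φ).integrable_norm_rpow hp0 hp
  have hnormφ : ‖φ‖ ^ q = N := by
    rw [Lp.norm_def, (Lp.memLp φ).eLpNorm_eq_integral_rpow_norm hp0 hp, ENNReal.toReal_ofReal
      (by positivity), ← Real.rpow_mul (by positivity), inv_mul_cancel₀ hq0.ne', Real.rpow_one]
  have hN : 0 < N := by
    rw [← hnormφ]
    exact Real.rpow_pos_of_pos (norm_pos_iff.2 hφ0) q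
  set a := ∫ t, fourier n t * (‖φ t‖ ^ q : ℝ) ∂haarAddCircle with ha
  set b := ∫ t, fourier n t * (‖φ t‖ ^ 2 : ℝ) ∂haarAddCircle with hb
  have hai := integrable_fourier_mul_ofReal hNi n
  have hbi := integrable_fourier_mul_ofReal hBi n
  suffices q * ((w * b).re / B) ≤ q * ((w * a).re / N) from le_of_mul_le_mul_left this hq0
  refine le_of_forall_small_linear (K := 3 * q ^ 2) (r := 1 / (2 * q)) (by positivity)
    fun ε hε hεq => ?_
  set H : Torus → ℂ := fun t => 1 + ε * w * fourier n t with hH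
  have hHc : Continuous H := by fun_prop
  have hz (t : Torus) : ‖(ε * w * fourier n t : ℂ)‖ = ε := by
    rw [norm_mul, norm_mul, hw, norm_fourier_apply, Complex.norm_real, Real.norm_of_nonneg hε.le]
    ring
  have hHmem : MemLp H ∞ haarAddCircle := by
    refine MemLp.of_bound hHc.aestronglyMeasurable (1 + ε) (Eventually.of_forall fun t => ?_)
    refine (norm_add_le _ _).trans ?_
    rw [hz, norm_one]
  have hHneg (k : ℤ) (hk : k < 0) : fourierCoeff H k = 0 := by
    have : H = (1 + Polynomial.monomial n (ε * w) : Polynomial ℂ).toAddCircle := by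
      ext t
      rw [map_add, map_one, Polynomial.toAddCircle_monomial_eq_smul_fourier]
      simp only [hH, ContinuousMap.add_apply, ContinuousMap.one_apply, ContinuousMap.smul_apply,
        smul_eq_mul]
    rw [this]
    exact Polynomial.fourierCoeff_toAddCircle_eq_zero_of_lt_zero _ _ hk
  have key := h.norm_mul_le hHmem hHneg
  have hleft : B + ε * (w * b).re ≤ ‖∫ t, H t * (‖φ t‖ ^ 2 : ℝ) ∂haarAddCircle‖ := by
    have : ∫ t, H t * (‖φ t‖ ^ 2 : ℝ) ∂haarAddCircle = B + ε * (w * b) := by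
      simp only [hH, add_mul, one_mul, mul_assoc]
      have hBc : Integrable (fun t => ((‖φ t‖ ^ 2 : ℝ) : ℂ)) haarAddCircle := hBi.ofReal
      rw [integral_add hBc ((hbi.const_mul w).const_mul _), integral_const_mul,
        integral_const_mul, integral_complex_ofReal]
    rw [this]
    refine le_trans (le_of_eq ?_) (Complex.re_le_norm _)
    rw [Complex.add_re, Complex.ofReal_re, Complex.re_ofReal_mul]
  have hGm : MemLp (fun t => φ t * H t) p haarAddCircle := hHmem.mul (Lp.memLp φ)
  set G := (eLpNorm (fun t => φ t * H t) p haarAddCircle).toReal with hG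
  have hG0 : 0 ≤ G := ENNReal.toReal_nonneg
  have hGq : G ^ q ≤ N + q * (ε * (w * a).re) + 3 * q ^ 2 * ε ^ 2 * N := by
    have h1 : G ^ q = ∫ t, ‖φ t * H t‖ ^ q ∂haarAddCircle := by
      rw [hG, hGm.eLpNorm_eq_integral_rpow_norm hp0 hp, ENNReal.toReal_ofReal
        (by positivity), ← Real.rpow_mul (by positivity), inv_mul_cancel₀ hq0.ne', Real.rpow_one]
    have hre : Integrable (fun t => (w * (fourier n t * (‖φ t‖ ^ q : ℝ))).re) haarAddCircle :=
      (hai.const_mul w).re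
    have hrei : ∫ t, (w * (fourier n t * (‖φ t‖ ^ q : ℝ))).re ∂haarAddCircle = (w * a).re := by
      rw [ha, ← integral_const_mul]
      exact integral_re (hai.const_mul w)
    calc G ^ q = ∫ t, ‖φ t * H t‖ ^ q ∂haarAddCircle := h1
      _ ≤ ∫ t, (‖φ t‖ ^ q + q * ε * (w * (fourier n t * (‖φ t‖ ^ q : ℝ))).re +
            3 * q ^ 2 * ε ^ 2 * ‖φ t‖ ^ q) ∂haarAddCircle := by
          refine integral_mono (hGm.integrable_norm_rpow hp0 hp)
            ((hNi.add (hre.const_mul _)).add (hNi.const_mul _)) fun t => ?_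
          have h3 := norm_one_add_rpow_le hq1 (hz t).le hεq
          have h4 : (ε * w * fourier n t : ℂ).re = ε * (w * fourier n t).re := by
            rw [mul_assoc, Complex.re_ofReal_mul]
          have h5 : (w * (fourier n t * (‖φ t‖ ^ q : ℝ))).re =
              (w * fourier n t).re * ‖φ t‖ ^ q := by
            rw [← mul_assoc, Complex.re_mul_ofReal]
          dsimp only
          rw [norm_mul, Real.mul_rpow (norm_nonneg _) (norm_nonneg _), h5]
          calc ‖φ t‖ ^ q * ‖H t‖ ^ q
              ≤ ‖φ t‖ ^ q * (1 + q * (ε * w * fourier n t : ℂ).re + 3 * q ^ 2 * ε ^ 2) := by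
                gcongr
            _ = _ := by rw [h4]; ring
      _ = N + q * ε * (w * a).re + 3 * q ^ 2 * ε ^ 2 * N := by
          have hsum : Integrable (fun t => ‖φ t‖ ^ q +
              q * ε * (w * (fourier n t * (‖φ t‖ ^ q : ℝ))).re) haarAddCircle :=
            hNi.add (hre.const_mul _)
          rw [integral_add hsum (hNi.const_mul _),
            integral_add hNi (hre.const_mul _), integral_const_mul, integral_const_mul, hrei]
      _ = _ := by ring
  have hbn : ‖b‖ ≤ B := by
    refine (norm_integral_le_integral_norm _).trans_eq ?_
    refine integral_congr_ae (Eventually.of_forall fun t => ?_)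
    dsimp only
    rw [norm_mul, norm_fourier_apply, one_mul, Complex.norm_real, Real.norm_of_nonneg (by positivity)]
  -- Needed for Bernoulli's inequality, which bounds the `q`-th power of the left side from below by
  -- its linear part.
  have hwb : -1 ≤ (w * b).re / B := by
    rw [le_div_iff₀ hB]
    have := (abs_le.1 (Complex.abs_re_le_norm (w * b))).1
    rw [norm_mul, hw, one_mul] at this
    linarith
  have hε1 : ε ≤ 1 := hεq.trans (by rw [div_le_one (by positivity)]; linarith)
  have hy : -1 ≤ ε * ((w * b).re / B) := by nlinarith
  have hmain : ‖φ‖ * (1 + ε * ((w * b).re / B)) ≤ G := by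
    have h3 : ‖φ‖ * (B + ε * (w * b).re) ≤ G * B :=
      (mul_le_mul_of_nonneg_left hleft (norm_nonneg _)).trans key
    have h4 : ‖φ‖ * (1 + ε * ((w * b).re / B)) * B = ‖φ‖ * (B + ε * (w * b).re) := by
      field_simp
    exact le_of_mul_le_mul_right (h4.trans_le h3) hB
  have hpow : N * (1 + ε * ((w * b).re / B)) ^ q ≤ G ^ q := by
    rw [← hnormφ, ← Real.mul_rpow (norm_nonneg _) (by linarith)]
    exact Real.rpow_le_rpow (mul_nonneg (norm_nonneg _) (by linarith)) hmain hq0.le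
  have hbern := one_add_mul_self_le_rpow_one_add hy hq1
  have h6 : N * (1 + ε * (q * ((w * b).re / B))) ≤
      N * (1 + ε * (q * ((w * a).re / N)) + 3 * q ^ 2 * ε ^ 2) := by
    calc N * (1 + ε * (q * ((w * b).re / B))) = N * (1 + q * (ε * ((w * b).re / B))) := by ring
      _ ≤ N * (1 + ε * ((w * b).re / B)) ^ q := by gcongr
      _ ≤ _ := hpow.trans hGq
      _ = _ := by field_simp
  exact le_of_mul_le_mul_left h6 hN

/-- The four values `±1`, `±I` of `w` suffice; here a one-sided variation becomes an equality. -/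
theorem eq_of_forall_re_mul_le {x y : ℂ} (h : ∀ w : ℂ, ‖w‖ = 1 → (w * x).re ≤ (w * y).re) :
    x = y := by
  have h1 := h 1 (by simp)
  have h2 := h (-1) (by simp)
  have h3 := h Complex.I (by simp)
  have h4 := h (-Complex.I) (by simp)
  simp at h1 h2 h3 h4
  exact Complex.ext (le_antisymm h1 h2) (le_antisymm h4 h3)

/-- Integrable real functions with the same Fourier coefficients of one sign agree. -/
theorem ae_eq_of_integral_fourier_mul_eq {u v : Torus → ℝ} (hu : Integrable u haarAddCircle)
    (hv : Integrable v haarAddCircle)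
    (h : ∀ n : ℕ, ∫ t, fourier n t * (u t : ℂ) ∂haarAddCircle =
      ∫ t, fourier n t * (v t : ℂ) ∂haarAddCircle) : u =ᵐ[haarAddCircle] v := by
  have hneg (n : ℕ) : fourierCoeff (fun t => (u t : ℂ)) (-n) =
      fourierCoeff (fun t => (v t : ℂ)) (-n) := by
    simp only [fourierCoeff, neg_neg, smul_eq_mul]
    exact h n
  have hconj (u : Torus → ℝ) (n : ℤ) : fourierCoeff (fun t => (u t : ℂ)) n =
      conj (fourierCoeff (fun t => (u t : ℂ)) (-n)) := by
    rw [← fourierCoeff_conj]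
    simp only [Complex.conj_ofReal]
  have hu' : Integrable (fun t => (u t : ℂ)) haarAddCircle := hu.ofReal
  have hv' : Integrable (fun t => (v t : ℂ)) haarAddCircle := hv.ofReal
  have := ae_eq_of_fourierCoeff_eq hu' hv' fun n => by
    rcases Int.eq_nat_or_neg n with ⟨m, rfl | rfl⟩
    · rw [hconj u, hconj v, hneg]
    · exact hneg m
  filter_upwards [this] with t ht
  exact_mod_cast ht

/-- For a Hilbert point, the normalized densities `|φ|^p` and `|φ|^2` agree. -/
theorem IsHilbertPoint.rpow_norm_ae_eq {p : ℝ≥0∞} [hp1 : Fact (1 ≤ p)] (hp : p ≠ ∞)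
    {φ : LpTorus p} (h : IsHilbertPoint φ) : ∀ᵐ t ∂(haarAddCircle : Measure Torus),
      ‖φ t‖ ^ 2 / ∫ t, ‖φ t‖ ^ 2 ∂haarAddCircle =
        ‖φ t‖ ^ p.toReal / ∫ t, ‖φ t‖ ^ p.toReal ∂haarAddCircle := by
  have hp0 : p ≠ 0 := (zero_lt_one.trans_le hp1.out).ne'
  have hBi : Integrable (fun t => ‖φ t‖ ^ 2) haarAddCircle :=
    h.memLp_two.integrable_norm_pow two_ne_zero
  have hNi : Integrable (fun t => ‖φ t‖ ^ p.toReal) haarAddCircle :=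
    (Lp.memLp φ).integrable_norm_rpow hp0 hp
  set B := ∫ t, ‖φ t‖ ^ 2 ∂haarAddCircle with hBdef
  set N := ∫ t, ‖φ t‖ ^ p.toReal ∂haarAddCircle with hNdef
  have hnat (n : ℕ) : (∫ t, fourier n t * (‖φ t‖ ^ 2 : ℝ) ∂haarAddCircle) / (B : ℂ) =
      (∫ t, fourier n t * (‖φ t‖ ^ p.toReal : ℝ) ∂haarAddCircle) / (N : ℂ) := by
    refine eq_of_forall_re_mul_le fun w hw => ?_
    rw [← mul_div_assoc, ← mul_div_assoc, Complex.div_ofReal_re, Complex.div_ofReal_re]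
    exact h.re_mul_coeff_le hp n hw
  have hdiv (u : Torus → ℝ) (c : ℝ) (n : ℕ) :
      ∫ t, fourier n t * ((u t / c : ℝ) : ℂ) ∂haarAddCircle =
        (∫ t, fourier n t * (u t : ℂ) ∂haarAddCircle) / (c : ℂ) := by
    rw [← integral_div]
    simp only [Complex.ofReal_div, mul_div_assoc]
  exact ae_eq_of_integral_fourier_mul_eq (hBi.div_const B) (hNi.div_const N) fun n =>
    (hdiv _ _ n).trans ((hnat n).trans (hdiv _ _ n).symm)

theorem IsHilbertPoint.exists_norm_eq_const_of_ne_top {p : ℝ≥0∞} [hp1 : Fact (1 ≤ p)] (hp : p ≠ ∞)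
    (hp2 : p ≠ 2) {φ : LpTorus p} (h : IsHilbertPoint φ) :
    ∃ c : ℝ, 0 < c ∧ ∀ᵐ t ∂(haarAddCircle : Measure Torus), ‖φ t‖ = c := by
  have hne := ae_ne_zero_of_mem_hardySpace_of_memLp h.1 h.2.1 h.memLp_two
  have heq := h.rpow_norm_ae_eq hp
  have hB := integral_norm_sq_pos h.2.1 h.memLp_two
  set B := ∫ t, ‖φ t‖ ^ 2 ∂haarAddCircle with hBdef
  set N := ∫ t, ‖φ t‖ ^ p.toReal ∂haarAddCircle with hNdef
  have hq : p.toReal - 2 ≠ 0 := by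
    rw [sub_ne_zero]
    intro h'
    exact hp2 ((ENNReal.toReal_eq_toReal_iff' hp (by simp)).1 (by simpa using h'))
  have hval : ∀ᵐ t ∂(haarAddCircle : Measure Torus),
      0 < ‖φ t‖ ∧ ‖φ t‖ = (N / B) ^ (p.toReal - 2)⁻¹ := by
    filter_upwards [hne, heq] with t h1 h2
    have hx : 0 < ‖φ t‖ := norm_pos_iff.2 h1
    refine ⟨hx, ?_⟩
    have hN : N ≠ 0 := by
      rintro h0
      rw [h0, div_zero] at h2
      exact (div_pos (pow_pos hx 2) hB).ne' h2
    -- Dividing by `|φ|²` is allowed where `φ ≠ 0`; the exponent `p - 2` is nonzero, so the modulus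
    -- can be solved for.
    have h3 : ‖φ t‖ ^ (p.toReal - 2) = N / B := by
      rw [Real.rpow_sub hx, Real.rpow_two]
      field_simp at h2 ⊢
      linarith
    rw [← h3, ← Real.rpow_mul hx.le, mul_inv_cancel₀ hq, Real.rpow_one]
  obtain ⟨t, ht⟩ := hval.exists
  exact ⟨_, ht.2 ▸ ht.1, hval.mono fun s hs => hs.2⟩

/-! ### The case `p = ∞` -/

theorem LpTorus.ae_norm_le (φ : LpTorus ∞) :
    ∀ᵐ t ∂(haarAddCircle : Measure Torus), ‖φ t‖ ≤ ‖φ‖ := by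
  have h := ae_le_eLpNormEssSup (f := (φ : Torus → ℂ)) (μ := haarAddCircle)
  filter_upwards [h] with t ht
  rw [Lp.norm_def, eLpNorm_exponent_top]
  have hfin := Lp.eLpNorm_ne_top φ
  rw [eLpNorm_exponent_top] at hfin
  simpa using ENNReal.toReal_mono hfin ht

/-- A lower bound for the real part of `exp (s z)` when `Re z ≤ 1`. -/
theorem le_re_exp_mul {z : ℂ} {s : ℝ} (hs : 0 ≤ s) (hs1 : s ≤ 1) (hz1 : z.re ≤ 1) :
    1 + s * z.re - 2 * s ^ 2 * ‖z‖ ^ 2 ≤ (Complex.exp (s * z)).re := by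
  rw [Complex.exp_re, Complex.re_ofReal_mul, Complex.im_ofReal_mul]
  have h1 : 1 - (s * z.im) ^ 2 / 2 ≤ Real.cos (s * z.im) := Real.one_sub_sq_div_two_le_cos
  have h2 := Real.add_one_le_exp (s * z.re)
  -- The crude bound `e ≤ 4`, times the `1 / 2` from the cosine, is the constant `2` in the
  -- statement.
  have h3 : Real.exp (s * z.re) ≤ 4 := by
    calc Real.exp (s * z.re) ≤ Real.exp 1 := Real.exp_le_exp.2 (by nlinarith)
      _ ≤ 4 := by linarith [Real.exp_one_lt_d9]
  have h4 : z.im ^ 2 ≤ ‖z‖ ^ 2 := by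
    rw [Complex.sq_norm, Complex.normSq_apply]
    nlinarith [sq_nonneg z.re]
  have h5 : (s * z.im) ^ 2 / 2 * Real.exp (s * z.re) ≤ 2 * s ^ 2 * ‖z‖ ^ 2 := by
    calc (s * z.im) ^ 2 / 2 * Real.exp (s * z.re) ≤ (s * z.im) ^ 2 / 2 * 4 := by gcongr
      _ = 2 * s ^ 2 * z.im ^ 2 := by ring
      _ ≤ _ := by gcongr
  have h6 := mul_le_mul_of_nonneg_left h1 (Real.exp_pos (s * z.re)).le
  linarith

/-- A Hilbert point of `H^∞` vanishes wherever its modulus is not close to the maximum. -/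
theorem IsHilbertPoint.ae_eq_zero_or_lt {φ : LpTorus ∞} (h : IsHilbertPoint φ) {δ : ℝ} (hδ : 0 < δ)
    (hδ1 : δ < 1) :
    ∀ᵐ t ∂(haarAddCircle : Measure Torus), φ t = 0 ∨ ‖φ‖ * (1 - δ) < ‖φ t‖ := by
  have hφ0 := h.2.1
  have h2 := h.memLp_two
  have hM : 0 < ‖φ‖ := norm_pos_iff.2 hφ0
  set M := ‖φ‖ with hMdef
  have hφM := LpTorus.ae_norm_le φ
  have hE : MeasurableSet {t | ‖φ t‖ ≤ M * (1 - δ)} :=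
    (Lp.stronglyMeasurable φ).measurable.norm measurableSet_Iic
  set E := {t | ‖φ t‖ ≤ M * (1 - δ)} with hEdef
  obtain ⟨F, hre, hF⟩ := exists_exp_analytic hE
  have hBi : Integrable (fun t => ‖φ t‖ ^ 2) haarAddCircle := h2.integrable_norm_pow two_ne_zero
  have hB := integral_norm_sq_pos hφ0 h2
  set B := ∫ t, ‖φ t‖ ^ 2 ∂haarAddCircle with hBdef
  have hFi : Integrable (fun t => ‖F t‖ ^ 2) haarAddCircle :=
    (Lp.memLp F).integrable_norm_pow two_ne_zero
  set ind : Torus → ℝ := E.indicator fun _ => (1 : ℝ) with hind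
  have hind01 (t : Torus) : 0 ≤ ind t ∧ ind t ≤ 1 := by
    by_cases ht : t ∈ E <;> simp [hind, ht]
  have hIi : Integrable (fun t => ind t * ‖φ t‖ ^ 2) haarAddCircle := by
    refine hBi.bdd_mul (c := 1) (measurable_const.indicator hE).aestronglyMeasurable
      (Eventually.of_forall fun t => ?_)
    rw [Real.norm_of_nonneg (hind01 t).1]
    exact (hind01 t).2
  set m := ∫ t, ind t * ‖φ t‖ ^ 2 ∂haarAddCircle with hm
  set K := 2 * M ^ 2 * ∫ t, ‖F t‖ ^ 2 ∂haarAddCircle with hK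
  -- The gain `s m` from `E` is first order in `s` and the loss `s² K` second order. Letting `s`
  -- tend to zero gives `m ≤ 0`.
  have hbound (s : ℝ) (hs : 0 < s) (hsδ : s ≤ δ) : s * m ≤ s * (s * K) := by
    have hHm := memLp_exp_of_re_eq_indicator hre hs.le ∞
    have key := h.norm_mul_le hHm (hF s hs.le).1
    have hexp : Real.exp s * (1 - δ) ≤ 1 := by
      have h1 := Real.add_one_le_exp (-s)
      have h3 : (1 - δ) ≤ Real.exp (-s) := by linarith
      calc Real.exp s * (1 - δ) ≤ Real.exp s * Real.exp (-s) := by gcongr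
        _ = 1 := by rw [← Real.exp_add, add_neg_cancel, Real.exp_zero]
    -- On `E` the factor `exp s` is absorbed by `1 - δ ≤ 1 - s ≤ exp (-s)`; off `E` the modulus of
    -- `φ` is unchanged.
    have hright : (eLpNorm (fun t => φ t * Complex.exp (s * F t)) ∞ haarAddCircle).toReal ≤ M := by
      have h1 : eLpNorm (fun t => φ t * Complex.exp (s * F t)) ∞ haarAddCircle ≤
          ENNReal.ofReal M := by
        rw [eLpNorm_exponent_top]
        refine eLpNormEssSup_le_of_ae_bound ?_
        filter_upwards [hre, hφM] with t ht1 ht2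
        rw [norm_mul, Complex.norm_exp, Complex.re_ofReal_mul, ht1]
        by_cases ht : t ∈ E
        · rw [hind, Set.indicator_of_mem ht, mul_one]
          calc ‖φ t‖ * Real.exp s ≤ M * (1 - δ) * Real.exp s := by gcongr; exact ht
            _ = M * (Real.exp s * (1 - δ)) := by ring
            _ ≤ M * 1 := by gcongr
            _ = M := mul_one M
        · rw [hind, Set.indicator_of_notMem ht, mul_zero, Real.exp_zero, mul_one]
          exact ht2
      exact (ENNReal.toReal_mono ENNReal.ofReal_ne_top h1).trans_eq (ENNReal.toReal_ofReal hM.le)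
    have hint : Integrable (fun t => Complex.exp (s * F t) * (‖φ t‖ ^ 2 : ℝ)) haarAddCircle :=
      (hBi.ofReal (𝕜 := ℂ)).mul_of_top_right hHm
    have h3 : ‖∫ t, Complex.exp (s * F t) * (‖φ t‖ ^ 2 : ℝ) ∂haarAddCircle‖ ≤ B := by
      refine le_of_mul_le_mul_left (key.trans ?_) hM
      gcongr
    have h4 : ∫ t, (Complex.exp (s * F t) * (‖φ t‖ ^ 2 : ℝ)).re ∂haarAddCircle ≤ B := by
      refine le_trans (le_of_eq ?_) ((Complex.re_le_norm _).trans h3)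
      exact integral_re hint
    have h5 : B + s * m - s ^ 2 * K ≤
        ∫ t, (Complex.exp (s * F t) * (‖φ t‖ ^ 2 : ℝ)).re ∂haarAddCircle := by
      have h6 : B + s * m - s ^ 2 * K = ∫ t, (‖φ t‖ ^ 2 + s * (ind t * ‖φ t‖ ^ 2) -
          s ^ 2 * (2 * M ^ 2) * ‖F t‖ ^ 2) ∂haarAddCircle := by
        have hsum : Integrable (fun t => ‖φ t‖ ^ 2 + s * (ind t * ‖φ t‖ ^ 2)) haarAddCircle :=
          hBi.add (hIi.const_mul s)
        rw [integral_sub hsum (hFi.const_mul _),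
          integral_add hBi (hIi.const_mul s), integral_const_mul, integral_const_mul]
        rw [hK]; ring
      rw [h6]
      refine integral_mono_ae ((hBi.add (hIi.const_mul s)).sub (hFi.const_mul _)) hint.re ?_
      filter_upwards [hre, hφM] with t ht1 ht2
      have h7 := le_re_exp_mul (z := F t) hs.le (hsδ.trans hδ1.le)
        (ht1 ▸ (hind01 t).2)
      have h8 : ‖φ t‖ ^ 2 ≤ M ^ 2 := by gcongr
      rw [ht1] at h7
      change _ ≤ (Complex.exp (s * F t) * (‖φ t‖ ^ 2 : ℝ)).re
      rw [Complex.re_mul_ofReal]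
      calc ‖φ t‖ ^ 2 + s * (ind t * ‖φ t‖ ^ 2) - s ^ 2 * (2 * M ^ 2) * ‖F t‖ ^ 2
          = ‖φ t‖ ^ 2 + s * (ind t * ‖φ t‖ ^ 2) - 2 * s ^ 2 * ‖F t‖ ^ 2 * M ^ 2 := by ring
        _ ≤ ‖φ t‖ ^ 2 + s * (ind t * ‖φ t‖ ^ 2) - 2 * s ^ 2 * ‖F t‖ ^ 2 * ‖φ t‖ ^ 2 := by gcongr
        _ = (1 + s * ind t - 2 * s ^ 2 * ‖F t‖ ^ 2) * ‖φ t‖ ^ 2 := by ring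
        _ ≤ _ := by gcongr
    nlinarith
  have hm0 : m ≤ 0 := by
    have hlim : Tendsto (fun s : ℝ => s * K) (𝓝[>] 0) (𝓝 (0 * K)) := by
      have : Continuous fun s : ℝ => s * K := by fun_prop
      exact (this.tendsto 0).mono_left nhdsWithin_le_nhds
    rw [zero_mul] at hlim
    refine ge_of_tendsto hlim ?_
    filter_upwards [Ioc_mem_nhdsGT hδ] with s hs
    exact le_of_mul_le_mul_left (hbound s hs.1 hs.2) hs.1
  have hnonneg (t : Torus) : 0 ≤ ind t * ‖φ t‖ ^ 2 := mul_nonneg (hind01 t).1 (by positivity)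
  have hzero := (integral_eq_zero_iff_of_nonneg hnonneg hIi).1
    (le_antisymm hm0 (integral_nonneg hnonneg))
  filter_upwards [hzero] with t ht
  by_cases hE' : t ∈ E
  · left
    simpa [hind, hE'] using ht
  · right
    exact not_le.1 hE'

/-- Nonvanishing rules out the alternative `φ t = 0`, and `δ` runs through a sequence tending to
zero; the `n + 2` keeps `δ < 1`. -/
theorem IsHilbertPoint.norm_eq_const_of_top {φ : LpTorus ∞} (h : IsHilbertPoint φ) :
    ∀ᵐ t ∂(haarAddCircle : Measure Torus), ‖φ t‖ = ‖φ‖ := by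
  have hne := ae_ne_zero_of_mem_hardySpace_of_memLp h.1 h.2.1 h.memLp_two
  have hall := ae_all_iff.2 fun n : ℕ => h.ae_eq_zero_or_lt (δ := 1 / (n + 2 : ℝ)) (by positivity)
    (by rw [div_lt_one (by positivity)]; linarith [(Nat.cast_nonneg n : (0 : ℝ) ≤ n)])
  filter_upwards [hne, hall, LpTorus.ae_norm_le φ] with t h1 h2 h3
  refine le_antisymm h3 ?_
  have hlim : Tendsto (fun n : ℕ => ‖φ‖ * (1 - 1 / (n + 2 : ℝ))) atTop (𝓝 (‖φ‖ * (1 - 0))) := by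
    refine Tendsto.const_mul _ (tendsto_const_nhds.sub ?_)
    have := (tendsto_add_atTop_iff_nat 2).2 (tendsto_one_div_atTop_nhds_zero_nat (𝕜 := ℝ))
    simpa using this
  rw [sub_zero, mul_one] at hlim
  exact le_of_tendsto hlim (Eventually.of_forall fun n => ((h2 n).resolve_left h1).le)

theorem exists_inner_of_norm_eq_const {p : ℝ≥0∞} [Fact (1 ≤ p)] {φ : LpTorus p}
    (hφ : φ ∈ hardySpace p) {c : ℝ} (hc : 0 < c)
    (h : ∀ᵐ t ∂(haarAddCircle : Measure Torus), ‖φ t‖ = c) :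
    ∃ C : ℂ, C ≠ 0 ∧ ∃ I : LpTorus p, IsInner I ∧ φ = C • I := by
  have hc' : (c : ℂ) ≠ 0 := Complex.ofReal_ne_zero.2 hc.ne'
  refine ⟨c, hc', (c : ℂ)⁻¹ • φ, ⟨Submodule.smul_mem _ _ hφ, ?_⟩, (smul_inv_smul₀ hc' φ).symm⟩
  filter_upwards [h, Lp.coeFn_smul (c : ℂ)⁻¹ φ] with t h1 h2
  rw [h2, Pi.smul_apply, norm_smul, h1, norm_inv, Complex.norm_real, Real.norm_of_nonneg hc.le,
    inv_mul_cancel₀ hc.ne']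

/-! ### Functions of constant modulus are Hilbert points -/

section Converse

variable {p : ℝ≥0∞} [Fact (1 ≤ p)] {φ : LpTorus p} {c : ℝ}

theorem integrable_mul_conj_of_norm_eq
    (h : ∀ᵐ t ∂(haarAddCircle : Measure Torus), ‖φ t‖ = c) (f : LpTorus p) :
    Integrable (fun t => f t * conj (φ t)) haarAddCircle := by
  refine (LpTorus.integrable f).mul_bdd (c := c)
    (Complex.continuous_conj.comp_aestronglyMeasurable (Lp.aestronglyMeasurable φ)) ?_
  filter_upwards [h] with t ht
  rw [RCLike.norm_conj, ht]

theorem norm_pairing_le_of_norm_eq (hc : 0 ≤ c)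
    (h : ∀ᵐ t ∂(haarAddCircle : Measure Torus), ‖φ t‖ = c) (f : LpTorus p) :
    ‖pairing f φ‖ ≤ c * ‖f‖ := by
  calc ‖pairing f φ‖ ≤ ∫ t, ‖f t * conj (φ t)‖ ∂haarAddCircle := norm_integral_le_integral_norm _
    _ = ∫ t, c * ‖f t‖ ∂haarAddCircle := by
        refine integral_congr_ae ?_
        filter_upwards [h] with t ht
        rw [norm_mul, RCLike.norm_conj, ht, mul_comm]
    _ = c * ∫ t, ‖f t‖ ∂haarAddCircle := integral_const_mul _ _
    _ ≤ c * ‖f‖ := by gcongr; exact LpTorus.integral_norm_le f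

/-- The pairing with a function of constant modulus, as a continuous functional. -/
noncomputable def pairingCLM (hc : 0 ≤ c)
    (h : ∀ᵐ t ∂(haarAddCircle : Measure Torus), ‖φ t‖ = c) : LpTorus p →L[ℂ] ℂ :=
  LinearMap.mkContinuous
    { toFun := fun f => pairing f φ
      map_add' := fun f g => by
        rw [pairing_congr_ae (Lp.coeFn_add f g) (ae_eq_refl _)]
        simp only [pairing, Pi.add_apply, add_mul]
        exact integral_add (integrable_mul_conj_of_norm_eq h f) (integrable_mul_conj_of_norm_eq h g)
      map_smul' := fun a f => by
        rw [pairing_congr_ae (Lp.coeFn_smul a f) (ae_eq_refl _)]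
        simp only [pairing, Pi.smul_apply, smul_eq_mul, mul_assoc, RingHom.id_apply]
        exact integral_const_mul _ _ }
    c (norm_pairing_le_of_norm_eq hc h)

theorem isHilbertPoint_of_norm_eq_const (hφ : φ ∈ hardySpace p) (hc : 0 < c)
    (h : ∀ᵐ t ∂(haarAddCircle : Measure Torus), ‖φ t‖ = c) : IsHilbertPoint φ := by
  have hp0 : p ≠ 0 := (zero_lt_one.trans_le (Fact.out : 1 ≤ p)).ne'
  set L := pairingCLM hc.le h with hL
  have hnorm : ‖φ‖ = c := by
    rw [Lp.norm_def, eLpNorm_congr_norm_ae (g := fun _ => c) (by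
      filter_upwards [h] with t ht
      rw [ht, Real.norm_of_nonneg hc.le]), eLpNorm_const _ hp0 (IsProbabilityMeasure.ne_zero _)]
    simp [hc.le]
  have hLφ : L φ = ((c ^ 2 : ℝ) : ℂ) := by
    change pairing φ φ = _
    have : pairing φ φ = ∫ _ : Torus, ((c ^ 2 : ℝ) : ℂ) ∂haarAddCircle := by
      refine integral_congr_ae ?_
      filter_upwards [h] with t ht
      rw [Complex.mul_conj, Complex.normSq_eq_norm_sq, ht]
    rw [this]
    simp
  refine ⟨hφ, fun h0 => ?_, fun f _ hf => ?_⟩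
  · rw [h0, norm_zero] at hnorm
    exact hc.ne hnorm
  · have hLf : L f = 0 := by
      rcases lt_or_ge p 2 with hp | hp
      -- As `φ` is bounded, the pairing is continuous on `L^p`, so its vanishing survives the limit
      -- of polynomials.
      · refine closure_minimal ?_ (isClosed_singleton.preimage L.continuous) (hf.2 hp)
        rintro g ⟨P, -, hg⟩
        exact hg
      · exact hf.1 hp
    have h1 : ‖L (φ + f)‖ ≤ c * ‖φ + f‖ := norm_pairing_le_of_norm_eq hc.le h _
    rw [map_add, hLf, add_zero, hLφ, Complex.norm_real, Real.norm_of_nonneg (by positivity), sq] at h1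
    rw [hnorm]
    exact le_of_mul_le_mul_left h1 hc

end Converse

theorem theorem1 (p : ℝ≥0∞) [Fact (1 ≤ p)] (hp : p ≠ 2) (φ : LpTorus p) :
    IsHilbertPoint φ ↔ ∃ C : ℂ, C ≠ 0 ∧ ∃ I : LpTorus p, IsInner I ∧ φ = C • I := by
  constructor
  · intro h
    by_cases hpt : p = ∞
    · subst hpt
      exact exists_inner_of_norm_eq_const h.1 (norm_pos_iff.2 h.2.1) h.norm_eq_const_of_top
    · obtain ⟨c, hc, hφ⟩ := h.exists_norm_eq_const_of_ne_top hpt hp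
      exact exists_inner_of_norm_eq_const h.1 hc hφ
  · rintro ⟨C, hC, I, ⟨hI, hI1⟩, rfl⟩
    refine isHilbertPoint_of_norm_eq_const (Submodule.smul_mem _ _ hI) (norm_pos_iff.2 hC) ?_
    filter_upwards [hI1, Lp.coeFn_smul C I] with t h1 h2
    rw [h2, Pi.smul_apply, norm_smul, h1, mul_one]
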